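/- Let $q\ge 4$ be a prime power, and let $C_q$ be the Veronese code: the linear code of length $q^2+q+1$ over $\mathbb F_q$ generated by the rows of a $6\times(q^2+q+1)$ matrix whose columns are coordinate vectors (chosen arbitrarily, in an arbitrary order, one for each point) of the points of the image of the Veronese map $\mathbb P^2(\mathbb F_q)\to\mathbb P^5(\mathbb F_q)$, $(x:y:z)\mapsto(x^2:xy:xz:y^2:yz:z^2)$. For an integer $w\ge 0$, the generalized weight polynomial $P_w\in\mathbb Z[Z]$ of $C_q$ is the unique polynomial such that, for every $m\ge 1$, $P_w(q^m)$ is the number of words of Hamming weight $w$ in the extended code $C_q\otimes_{\mathbb F_q}\mathbb F_{q^m}\subseteq\mathbb F_{q^m}^{\,q^2+q+1}$. Then the polynomials $P_w$ exist, and exactly nine of them are nonzero, namely those with $w\in\{0,\ q^2-q,\ q^2-1,\ q^2,\ q^2+q-3,\ q^2+q-2,\ q^2+q-1,\ q^2+q,\ q^2+q+1\}$. They are \begin{align*} P_0(Z)&=1,\\ P_{q^2-q}(Z)&=\binom{q^2+q+1}{2}(Z-1),\\ P_{q^2-1}(Z)&=(q^2+q+1)q^2(Z-q)(Z-1),\\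 P_{q^2}(Z)&=(q^2+q+1)(Z-1)\bigl(Z^2-(q^2-1)Z+2q^3-2q^2-q+1\bigr),\\ P_{q^2+q-3}(Z)&=\tfrac1{24}(q^2+q+1)(q+1)q^3(q-1)^2(Z-q)(Z-1),\\ P_{q^2+q-2}(Z)&=\tfrac16(q^2+q+1)(q+1)q^3(Z-1)(Z-q)\bigl(Z-(q^2-3q+3)\bigr),\\ P_{q^2+q-1}(Z)&=\tfrac14(q^2+q+1)(q+1)q(Z-1)(Z-q)\bigl(2Z^2-2(q^2-q)Z+(q^4-4q^3+7q^2-4q)\bigr),\\ P_{q^2+q}(Z)&=\tfrac16(q^2+q+1)(Z-1)\bigl(6Z^4-(6q^2+6q-6)Z^3+(3q^4+3q^3-6q)Z^2\\ &\qquad-(q^6-q^5+5q^4-5q^3-6q^2+6q)Z+(q^7-4q^6+8q^5-5q^4-6q^3+9q^2-3q)\bigr),\\ P_{q^2+q+1}(Z)&=\tfrac1{24}(Z-1)(Z-q)\bigl(24Z^4-24q^2Z^3+(12q^4-12q)Z^2\\ &\qquad-(4q^6-4q^5+8q^4-20q^3+12q^2)Z+(q^8-4q^7+11q^6-17q^5+12q^4-3q^3)\bigr).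 \end{align*} -/

import Mathlib

open Polynomial
open scoped LinearAlgebra.Projectivization

universe u

/-- The vector of all monomials of degree two in the coordinates `(x, y, z)`:
`(x², xy, xz, y², yz, z²)`. -/
def veroneseVec {F : Type u} [Field F] (v : Fin 3 → F) : Fin 6 → F :=
  ![v 0 ^ 2, v 0 * v 1, v 0 * v 2, v 1 ^ 2, v 1 * v 2, v 2 ^ 2]

theorem veroneseVec_ne_zero {F : Type u} [Field F] {v : Fin 3 → F} (hv : v ≠ 0) :
    veroneseVec v ≠ 0 := by
  intro h
  apply hv
  have h0 : v 0 ^ 2 = 0 := congrFun h 0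
  have h1 : v 1 ^ 2 = 0 := congrFun h 3
  have h2 : v 2 ^ 2 = 0 := congrFun h 5
  funext i
  fin_cases i
  · exact pow_eq_zero_iff two_ne_zero |>.mp h0
  · exact pow_eq_zero_iff two_ne_zero |>.mp h1
  · exact pow_eq_zero_iff two_ne_zero |>.mp h2

theorem veroneseVec_smul {F : Type u} [Field F] (a : F) (v : Fin 3 → F) :
    veroneseVec (a • v) = a ^ 2 • veroneseVec v := by
  funext i
  fin_cases i <;> simp [veroneseVec] <;> ring

/-- The Veronese map `ℙ² → ℙ⁵` over `F`. -/
def veroneseMap (F : Type u) [Field F] : ℙ F (Fin 3 → F) → ℙ F (Fin 6 → F) :=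
  Projectivization.lift
    (fun v => Projectivization.mk F (veroneseVec v.1) (veroneseVec_ne_zero v.2))
    (by
      intro v w t h
      rw [Projectivization.mk_eq_mk_iff']
      exact ⟨t ^ 2, by rw [h, veroneseVec_smul]⟩)

/-- The set of `F`-points `V_q` of the Veronese surface: the image of the Veronese map. -/
def veroneseSurface (F : Type u) [Field F] : Set (ℙ F (Fin 6 → F)) :=
  Set.range (veroneseMap F)

/-- `G` is a generator matrix `G_q` of the Veronese code: its columns are coordinate vectors
(chosen arbitrarily) of the points of the Veronese surface (in an arbitrary order), each point
occurring exactly once. -/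
def IsVeroneseMatrix {F : Type u} [Field F] {n : ℕ} (G : Matrix (Fin 6) (Fin n) F) : Prop :=
  ∃ h : ∀ j, G.col j ≠ 0,
    Set.BijOn (fun j => Projectivization.mk F (G.col j) (h j)) Set.univ (veroneseSurface F)

/-- The linear code with generator matrix `G`, i.e. the row space of `G`. -/
def rowCode {F : Type u} [Field F] {k n : ℕ} (G : Matrix (Fin k) (Fin n) F) :
    Submodule F (Fin n → F) :=
  Submodule.span F (Set.range G.row)

/-- The extension `C ⊗_F K` of a code `C ⊆ F^n` to an extension field `K`, as a subspace of
`K^n`: the `K`-span of the words of `C`. -/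
def extendCode {F : Type u} [Field F] {n : ℕ} (C : Submodule F (Fin n → F))
    (K : Type u) [Field K] [Algebra F K] : Submodule K (Fin n → K) :=
  Submodule.span K ((fun (c : Fin n → F) (i : Fin n) => algebraMap F K (c i)) '' C)

/-- The Hamming weight of a word: the cardinality of its support. -/
noncomputable def wordWeight {K : Type u} [Field K] {n : ℕ} (c : Fin n → K) : ℕ :=
  (Function.support c).ncard

/-- `P` is the `w`-th generalized weight polynomial of the code `C` over the finite field `F`
with `q` elements: `P(q^m)` is the number of words of weight `w` in `C ⊗_F K`, for every `m ≥ 1`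
and every extension `K` of `F` of degree `m`. -/
def IsGenWeightPoly {F : Type u} [Field F] {n : ℕ} (C : Submodule F (Fin n → F))
    (w : ℕ) (P : ℤ[X]) : Prop :=
  ∀ m : ℕ, 1 ≤ m → ∀ (K : Type u) [Field K] [Algebra F K], Module.finrank F K = m →
    P.eval ((Nat.card F : ℤ) ^ m)
      = ({c : Fin n → K | c ∈ extendCode C K ∧ wordWeight c = w}.ncard : ℤ)

/-! Let `K` extend `F` with `z` elements. A word of the extended code is a quadratic form over `K`
evaluated, up to nonzero scalars, at the `F`-points of the plane, so its weight is `n` minus the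
number of `F`-rational zeros of a conic over `K`. The task is to count nonzero forms by that number.

If the conic contains a rational line, its rational zeros are the line, the line and one more point,
or two lines (`line_type`). For a fixed line, the moments of orders 0, 1 and 2 of the number of
zeros off it give the counts; double counting over lines gives the totals (`card_lineConics`).

If it contains no rational line, its zeros form an arc. Five points of an arc determine a form up to
scalar, over `F` as well as over `K`; hence a conic with at least five rational zeros is a multiple
of one over `F` and has `q + 1` of them (`card_zeroSet_of_mem_arcConics`). The number of such forms
is `z - 1` times a quantity depending only on the plane (`card_arcConics_mul`), which is found in
the case `K = F`, where the third moment leaves one unknown.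

So the possible numbers of zeros are 0, 1, 2, 3, 4, `q + 1`, `q + 2` and `2q + 1`, and the last
three counts are known. The other five follow from the binomial moments of orders 0 to 4 (`moment`,
`moment_four`): up to three points impose independent conditions, and four do so unless collinear.
The results are polynomials in `z`; they are integral by congruences in `q`, and are determined by
their values at the powers of `q`.

The counting is axiomatized in `IsConicSystem`, so that it applies to forms over `F` and over `K` on
the same plane. -/

set_option linter.unusedSectionVars false

/-! ### Linear conditions imposed on conics by points of a projective plane -/

section ConicSystem

open Finset Configuration
open scoped Classical

/-- The set of points on a line, as a finset. -/
noncomputable def linePoints (P : Type*) {L : Type*} [Membership P L] [Fintype P] (l : L) :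
    Finset P :=
  {p | p ∈ l}

@[simp] theorem mem_linePoints {P L : Type*} [Membership P L] [Fintype P] {l : L} {p : P} :
    p ∈ linePoints P l ↔ p ∈ l := by
  simp [linePoints]

theorem card_linePoints {P L : Type*} [Membership P L] [ProjectivePlane P L] [Fintype P]
    [Finite L] (l : L) : #(linePoints P l) = ProjectivePlane.order P L + 1 := by
  rw [← ProjectivePlane.pointCount_eq (P := P) l, pointCount, Nat.card_eq_fintype_card,
    Fintype.card_subtype, linePoints]

theorem linePoints_inter_card {P L : Type*} [Membership P L] [ProjectivePlane P L] [Fintype P]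
    {l m : L} (h : l ≠ m) : #(linePoints P l ∩ linePoints P m) = 1 := by
  rw [card_eq_one]
  refine ⟨HasPoints.mkPoint h, ?_⟩
  have hx := HasPoints.mkPoint_ax (P := P) h
  ext p
  simp only [mem_inter, mem_linePoints, mem_singleton]
  constructor
  · rintro ⟨h1, h2⟩
    exact (Nondegenerate.eq_or_eq h1 hx.1 h2 hx.2).resolve_right h
  · rintro rfl
    exact hx

theorem exists_line_avoiding {P L : Type*} [Membership P L] [ProjectivePlane P L] [Fintype P]
    [Finite L] {p r : P} (h : p ≠ r) : ∃ l : L, p ∈ l ∧ r ∉ l := by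
  by_contra! hc
  have h2 := ProjectivePlane.two_lt_lineCount (L := L) p
  have hf : Finite {l : L // p ∈ l} := inferInstance
  have : Subsingleton {l : L // p ∈ l} :=
    ⟨fun a b => Subtype.ext ((Nondegenerate.eq_or_eq a.2 (hc _ a.2) b.2 (hc _ b.2)).resolve_left h)⟩
  have := Finite.card_le_one_iff_subsingleton (α := {l : L // p ∈ l}) |>.2 this
  rw [lineCount] at h2
  omega

section Evaluation

variable {P K A : Type*} [Fintype P] [Field K] [AddCommGroup A] [Module K A]

/-- The points at which a form vanishes. -/
noncomputable def zeroSet (ev : P → A →ₗ[K] K) (a : A) : Finset P := {p | ev p a = 0}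

@[simp] theorem mem_zeroSet {ev : P → A →ₗ[K] K} {a : A} {p : P} :
    p ∈ zeroSet ev a ↔ ev p a = 0 := by
  simp [zeroSet]

theorem zeroSet_smul (ev : P → A →ₗ[K] K) (a : A) {c : K} (hc : c ≠ 0) :
    zeroSet ev (c • a) = zeroSet ev a := by
  ext p
  simp [hc]

variable [Fintype A]

/-- The forms vanishing on a set of points. -/
noncomputable def vanishing (ev : P → A →ₗ[K] K) (T : Finset P) : Finset A :=
  {a | T ⊆ zeroSet ev a}

@[simp] theorem mem_vanishing {ev : P → A →ₗ[K] K} {a : A} {T : Finset P} :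
    a ∈ vanishing ev T ↔ T ⊆ zeroSet ev a := by
  simp [vanishing]

theorem zero_mem_vanishing (ev : P → A →ₗ[K] K) (T : Finset P) : 0 ∈ vanishing ev T := by
  simp [Finset.subset_iff]

/-- Imposing one further, independent, linear condition divides the number of forms by the
cardinality of the field. -/
theorem card_vanishing_insert [Fintype K] {ev : P → A →ₗ[K] K} {T : Finset P} {p : P}
    (h : ∃ a, T ⊆ zeroSet ev a ∧ ev p a ≠ 0) :
    #(vanishing ev T) = Fintype.card K * #(vanishing ev (insert p T)) := by
  obtain ⟨a, haT, hap⟩ := h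
  rw [← Finset.card_univ, ← card_product]
  symm
  refine Finset.card_nbij' (fun x => x.2 + (x.1 / ev p a) • a)
    (fun b => (ev p b, b - (ev p b / ev p a) • a)) ?_ ?_ ?_ ?_
  · rintro ⟨k, b⟩ hb
    simp only [coe_product, coe_univ, Set.mem_prod, Set.mem_univ, true_and, mem_coe,
      mem_vanishing, insert_subset_iff] at hb ⊢
    intro r hr
    have h1 := mem_zeroSet.1 (hb.2 hr)
    have h2 := mem_zeroSet.1 (haT hr)
    simp [h1, h2]
  · intro b hb
    simp only [coe_product, coe_univ, Set.mem_prod, Set.mem_univ, true_and, mem_coe,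
      mem_vanishing, insert_subset_iff, mem_zeroSet] at hb ⊢
    refine ⟨by simp [hap], fun r hr => ?_⟩
    have h1 := mem_zeroSet.1 (hb hr)
    have h2 := mem_zeroSet.1 (haT hr)
    simp [h1, h2]
  · rintro ⟨k, b⟩ hb
    simp only [coe_product, coe_univ, Set.mem_prod, Set.mem_univ, true_and, mem_coe,
      mem_vanishing, insert_subset_iff, mem_zeroSet] at hb
    simp [hb.1, hap]
  · intro b hb
    simp

/-- Double counting of pairs consisting of a form vanishing on `B` and `j` further zeros. -/
theorem sum_choose_zeroSet (ev : P → A →ₗ[K] K) (B : Finset P) (j : ℕ) :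
    ∑ a ∈ vanishing ev B, (#(zeroSet ev a \ B)).choose j
      = ∑ T ∈ powersetCard j Bᶜ, #(vanishing ev (B ∪ T)) := by
  simp_rw [← card_powersetCard, card_eq_sum_ones]
  refine Finset.sum_comm' ?_
  intro a T
  simp only [mem_vanishing, mem_powersetCard, subset_iff, mem_sdiff, mem_compl]
  grind

end Evaluation

/-- The properties of the evaluation of conics at the points of a projective plane. -/
structure IsConicSystem {P K A : Type*} (L : Type*) [Membership P L] [Field K] [AddCommGroup A]
    [Module K A] (ev : P → A →ₗ[K] K) : Prop where
  exists_pair : ∀ l m : L, ∃ a, ∀ p, ev p a = 0 ↔ p ∈ l ∨ p ∈ m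
  line : ∀ (l : L) (p₁ p₂ p₃ : P), p₁ ∈ l → p₂ ∈ l → p₃ ∈ l → p₁ ≠ p₂ → p₁ ≠ p₃ → p₂ ≠ p₃ →
    ∀ a, ev p₁ a = 0 → ev p₂ a = 0 → ev p₃ a = 0 → ∀ p ∈ l, ev p a = 0
  card : Nat.card A = Nat.card K ^ 6

namespace IsConicSystem

variable {P L K A : Type*} [Membership P L] [ProjectivePlane P L] [Fintype P] [Fintype L]
  [Field K] [Fintype K] [AddCommGroup A] [Module K A] [Fintype A] {ev : P → A →ₗ[K] K}

theorem linePoints_subset (h : IsConicSystem L ev) {l : L} {T : Finset P}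
    (hT : T ⊆ linePoints P l) (hc : 3 ≤ #T) {a : A} (ha : T ⊆ zeroSet ev a) :
    linePoints P l ⊆ zeroSet ev a := by
  obtain ⟨x, hx, y, hy, z, hz, hxy, hxz, hyz⟩ := two_lt_card.1 hc
  intro p hp
  rw [mem_zeroSet]
  exact h.line l x y z (mem_linePoints.1 (hT hx)) (mem_linePoints.1 (hT hy))
    (mem_linePoints.1 (hT hz)) hxy hxz hyz a (mem_zeroSet.1 (ha hx)) (mem_zeroSet.1 (ha hy))
    (mem_zeroSet.1 (ha hz)) p (mem_linePoints.1 hp)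

/-- Take a pair of lines, each through one point of `T` and missing `p`. A point other than `p` pads
`T` when it has fewer than two elements. -/
theorem exists_separating (h : IsConicSystem L ev) {T : Finset P} (hT : #T ≤ 2) {p : P}
    (hp : p ∉ T) : ∃ a, T ⊆ zeroSet ev a ∧ ev p a ≠ 0 := by
  obtain ⟨x, y, hx, hy, hxy⟩ : ∃ x y, x ≠ p ∧ y ≠ p ∧ T ⊆ {x, y} := by
    obtain ⟨r, hr⟩ : ∃ r, r ≠ p := by
      obtain ⟨l, hl⟩ := Nondegenerate.exists_line (L := L) p
      obtain ⟨r, hr⟩ : (linePoints P l).Nonempty := by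
        rw [← card_pos, card_linePoints]; omega
      exact ⟨r, fun e => hl (e ▸ mem_linePoints.1 hr)⟩
    interval_cases h0 : #T
    · exact ⟨r, r, hr, hr, by simp [card_eq_zero.1 h0]⟩
    · obtain ⟨x, rfl⟩ := card_eq_one.1 h0
      exact ⟨x, x, by simpa [eq_comm] using hp, by simpa [eq_comm] using hp, by simp⟩
    · obtain ⟨x, y, -, rfl⟩ := card_eq_two.1 h0
      simp only [mem_insert, mem_singleton, not_or] at hp
      exact ⟨x, y, Ne.symm hp.1, Ne.symm hp.2, subset_rfl⟩
  obtain ⟨l, hl, hl'⟩ := exists_line_avoiding (L := L) hx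
  obtain ⟨m, hm, hm'⟩ := exists_line_avoiding (L := L) hy
  obtain ⟨a, ha⟩ := h.exists_pair l m
  refine ⟨a, fun r hr => ?_, by simp [ha, hl', hm']⟩
  have := hxy hr
  simp only [mem_insert, mem_singleton] at this
  rw [mem_zeroSet, ha]
  rcases this with rfl | rfl <;> simp [hl, hm]

theorem card_vanishing_mul (h : IsConicSystem L ev) {T : Finset P} (hT : #T ≤ 3) :
    #(vanishing ev T) * Fintype.card K ^ #T = Fintype.card K ^ 6 := by
  induction T using Finset.induction_on with
  | empty =>
    have : vanishing ev ∅ = univ := by ext; simp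
    rw [this, card_univ, ← Nat.card_eq_fintype_card, h.card, Nat.card_eq_fintype_card]
    simp
  | insert p T hp ih =>
    rw [card_insert_of_notMem hp] at hT ⊢
    have := ih (by omega)
    rw [card_vanishing_insert (h.exists_separating (by omega) hp)] at this
    rw [← this]
    ring

theorem card_vanishing (h : IsConicSystem L ev) {T : Finset P} (hT : #T ≤ 3) :
    #(vanishing ev T) = Fintype.card K ^ (6 - #T) := by
  have := h.card_vanishing_mul hT
  have h0 : 0 < Fintype.card K ^ #T := pow_pos Fintype.card_pos _
  refine Nat.eq_of_mul_eq_mul_right h0 ?_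
  rw [this, ← pow_add]
  congr 1
  omega

/-- Any three points of `T` already force the whole line, so they impose the same conditions as `T`.
-/
theorem card_vanishing_collinear (h : IsConicSystem L ev) {l : L} {T : Finset P}
    (hT : T ⊆ linePoints P l) (hc : 3 ≤ #T) : #(vanishing ev T) = Fintype.card K ^ 3 := by
  obtain ⟨S, hS, hSc⟩ := exists_subset_card_eq hc
  have : vanishing ev T = vanishing ev S := by
    ext a
    simp only [mem_vanishing]
    exact ⟨fun ha => hS.trans ha, fun ha =>
      hT.trans (h.linePoints_subset (hS.trans hT) hSc.ge ha)⟩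
  rw [this, h.card_vanishing hSc.le, hSc]

theorem three_le_card_linePoints (l : L) : 3 ≤ #(linePoints P l) := by
  rw [card_linePoints]
  have := ProjectivePlane.one_lt_order P L
  omega

theorem card_vanishing_linePoints (h : IsConicSystem L ev) (l : L) :
    #(vanishing ev (linePoints P l)) = Fintype.card K ^ 3 :=
  h.card_vanishing_collinear subset_rfl (three_le_card_linePoints l)

theorem card_vanishing_line_point (h : IsConicSystem L ev) {l : L} {p : P} (hp : p ∉ l) :
    #(vanishing ev (insert p (linePoints P l))) = Fintype.card K ^ 2 := by
  obtain ⟨a, ha⟩ := h.exists_pair l l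
  have := card_vanishing_insert (ev := ev) (T := linePoints P l) (p := p)
    ⟨a, fun r hr => by simpa [ha] using hr, by simp [ha, hp]⟩
  rw [h.card_vanishing_linePoints] at this
  refine Nat.eq_of_mul_eq_mul_left (Fintype.card_pos (α := K)) ?_
  rw [← this]
  ring

/-- The line `l` together with a line through `p` missing `r` shows that `r` is a further
independent condition. -/
theorem card_vanishing_line_two_points (h : IsConicSystem L ev) {l : L} {p r : P} (hp : p ∉ l)
    (hr : r ∉ l) (hpr : p ≠ r) :
    #(vanishing ev (insert r (insert p (linePoints P l)))) = Fintype.card K := by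
  obtain ⟨m, hm, hm'⟩ := exists_line_avoiding (L := L) hpr
  obtain ⟨a, ha⟩ := h.exists_pair l m
  have := card_vanishing_insert (ev := ev) (T := insert p (linePoints P l)) (p := r)
    ⟨a, fun r hr => by
      simp only [mem_insert, mem_linePoints] at hr
      rw [mem_zeroSet, ha]
      rcases hr with rfl | hr
      · exact Or.inr hm
      · exact Or.inl hr, by simp [ha, hr, hm']⟩
  rw [h.card_vanishing_line_point hp] at this
  refine Nat.eq_of_mul_eq_mul_left (Fintype.card_pos (α := K)) ?_
  rw [← this]
  ring

/-- A nonzero conic containing a line and two further points is the union of two lines. -/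
theorem zeroSet_eq_union (h : IsConicSystem L ev) {a : A} (ha0 : a ≠ 0) {l m : L} (hlm : l ≠ m)
    (hl : linePoints P l ⊆ zeroSet ev a) {p r : P} (hp : p ∉ l) (hr : r ∉ l) (hpr : p ≠ r)
    (hpm : p ∈ m) (hrm : r ∈ m) (hpa : ev p a = 0) (hra : ev r a = 0) :
    zeroSet ev a = linePoints P l ∪ linePoints P m := by
  have hx := HasPoints.mkPoint_ax (P := P) hlm
  have hsub : linePoints P l ∪ linePoints P m ⊆ zeroSet ev a := by
    refine union_subset hl fun s hs => ?_
    rw [mem_zeroSet]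
    refine h.line m (HasPoints.mkPoint hlm) p r hx.2 hpm hrm ?_ ?_ hpr a ?_ hpa hra s
      (mem_linePoints.1 hs)
    · intro e; exact hp (e ▸ hx.1)
    · intro e; exact hr (e ▸ hx.1)
    · exact mem_zeroSet.1 (hl (mem_linePoints.2 hx.1))
  refine Subset.antisymm (fun s hs => ?_) hsub
  by_contra hsn
  obtain ⟨b, hb⟩ := h.exists_pair l m
  simp only [mem_union, mem_linePoints, not_or] at hsn
  have hbT : insert r (insert p (linePoints P l)) ⊆ zeroSet ev b := by
    intro t ht
    simp only [mem_insert, mem_linePoints] at ht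
    rw [mem_zeroSet, hb]
    rcases ht with rfl | rfl | ht <;> tauto
  -- The line pair `b` does not vanish at `s`, so requiring a zero at `s` cuts the `|K|` forms down
  -- to one. As `a` vanishes there too, it would be zero.
  have hcard := card_vanishing_insert (ev := ev) (T := insert r (insert p (linePoints P l)))
    (p := s) ⟨b, hbT, by simp [hb, hsn]⟩
  rw [h.card_vanishing_line_two_points hp hr hpr] at hcard
  have h1 : #(vanishing ev (insert s (insert r (insert p (linePoints P l))))) = 1 := by
    refine Nat.eq_of_mul_eq_mul_left (Fintype.card_pos (α := K)) ?_
    rw [← hcard, mul_one]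
  refine ha0 (card_le_one.1 h1.le a ?_ 0 (zero_mem_vanishing _ _))
  rw [mem_vanishing]
  intro t ht
  simp only [mem_insert] at ht
  rcases ht with rfl | rfl | rfl | ht
  · exact hs
  · exact mem_zeroSet.2 hra
  · exact mem_zeroSet.2 hpa
  · exact hl ht

/-- A line through two of the points and a line through a third can be chosen to miss the fourth, so
the fourth condition is independent of the other three. -/
theorem card_vanishing_noncollinear (h : IsConicSystem L ev) {T : Finset P} (hT : #T = 4)
    (hn : ¬ ∃ l : L, T ⊆ linePoints P l) : #(vanishing ev T) = Fintype.card K ^ 2 := by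
  suffices hs : ∃ p ∈ T, ∃ a, T.erase p ⊆ zeroSet ev a ∧ ev p a ≠ 0 by
    obtain ⟨p, hp, ha⟩ := hs
    have := card_vanishing_insert ha
    rw [insert_erase hp, h.card_vanishing (by rw [card_erase_of_mem hp]; omega),
      card_erase_of_mem hp, hT] at this
    refine Nat.eq_of_mul_eq_mul_left (Fintype.card_pos (α := K)) ?_
    rw [← this]
    ring
  obtain ⟨d, S, hd, rfl, hS⟩ := card_eq_succ.1 hT
  obtain ⟨x, y, z, hxy, hxz, hyz, rfl⟩ := card_eq_three.1 hS
  simp only [mem_insert, mem_singleton, not_or] at hd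
  obtain ⟨hdx, hdy, hdz⟩ := hd
  refine ⟨d, mem_insert_self _ _, ?_⟩
  rw [erase_insert (by simp [hdx, hdy, hdz])]
  have hax := HasLines.mkLine_ax (L := L) hxy
  have hax' := HasLines.mkLine_ax (L := L) hxz
  set l : L := HasLines.mkLine hxy
  set l' : L := HasLines.mkLine hxz
  by_cases hdl : d ∈ l
  · have hzl : z ∉ l := by
      intro hzl
      refine hn ⟨l, ?_⟩
      simp [insert_subset_iff, hax, hdl, hzl]
    have hll : l ≠ l' := fun e => hzl (e ▸ hax'.2)
    have hdl' : d ∉ l' := fun hd' =>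
      hll ((Nondegenerate.eq_or_eq hdl hax.1 hd' hax'.1).resolve_left hdx)
    obtain ⟨m, hm, hm'⟩ := exists_line_avoiding (L := L) (Ne.symm hdy)
    obtain ⟨a, ha⟩ := h.exists_pair l' m
    exact ⟨a, by simp [insert_subset_iff, ha, hax', hm], by simp [ha, hdl', hm']⟩
  · obtain ⟨m, hm, hm'⟩ := exists_line_avoiding (L := L) (Ne.symm hdz)
    obtain ⟨a, ha⟩ := h.exists_pair l m
    exact ⟨a, by simp [insert_subset_iff, ha, hax, hm], by simp [ha, hdl, hm']⟩

end IsConicSystem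

end ConicSystem

/-! ### Conics containing a line, and conics whose points form an arc -/

section ConicCounts

open Finset Configuration
open scoped Classical

theorem sum_comp_eq_sum_card_mul {α R : Type*} [CommSemiring R] (s : Finset α) (g : α → ℕ)
    (f : ℕ → R) (t : Finset ℕ) (h : ∀ x ∈ s, g x ∈ t) :
    ∑ x ∈ s, f (g x) = ∑ k ∈ t, (#{x ∈ s | g x = k} : R) * f k := by
  rw [← sum_fiberwise_of_maps_to h]
  refine sum_congr rfl fun k _ => ?_
  rw [sum_congr rfl (g := fun _ => f k) (fun x hx => by rw [(mem_filter.1 hx).2])]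
  simp

theorem sum_powersetCard_one {α M : Type*} [AddCommMonoid M] (s : Finset α) (f : Finset α → M) :
    ∑ T ∈ powersetCard 1 s, f T = ∑ x ∈ s, f {x} := by
  simp [powersetCard_one, sum_map]

namespace IsConicSystem

variable {P L K A : Type*} [Membership P L] [ProjectivePlane P L] [Fintype P] [Fintype L]
  [Field K] [Fintype K] [AddCommGroup A] [Module K A] [Fintype A] {ev : P → A →ₗ[K] K}

variable (L) in
/-- The lines contained in the conic `a`. -/
noncomputable def linesIn (ev : P → A →ₗ[K] K) (a : A) : Finset L :=
  {l | linePoints P l ⊆ zeroSet ev a}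

@[simp] theorem mem_linesIn {a : A} {l : L} :
    l ∈ linesIn L ev a ↔ linePoints P l ⊆ zeroSet ev a := by
  simp [linesIn]

theorem card_linePoints_sdiff {l m : L} (h : l ≠ m) :
    #(linePoints P m \ linePoints P l) = ProjectivePlane.order P L := by
  rw [card_sdiff, linePoints_inter_card h, card_linePoints]
  omega

theorem card_zeroSet_of_mem {a : A} {l : L} (hl : l ∈ linesIn L ev a) :
    #(zeroSet ev a) = ProjectivePlane.order P L + 1 + #(zeroSet ev a \ linePoints P l) := by
  rw [← card_linePoints l, add_comm, card_sdiff_add_card_eq_card (mem_linesIn.1 hl)]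

/-- A conic containing a line is the line with at most one further point, or two lines. -/
theorem line_type (h : IsConicSystem L ev) {a : A} (ha0 : a ≠ 0) {l : L}
    (hl : l ∈ linesIn L ev a) :
    #(zeroSet ev a \ linePoints P l) ≤ 1 ∧ #(linesIn L ev a) = 1 ∨
      #(zeroSet ev a \ linePoints P l) = ProjectivePlane.order P L ∧ #(linesIn L ev a) = 2 := by
  have hq := ProjectivePlane.one_lt_order P L
  have hl' := mem_linesIn.1 hl
  by_cases ht : #(zeroSet ev a \ linePoints P l) ≤ 1
  · refine Or.inl ⟨ht, card_eq_one.2 ⟨l, ?_⟩⟩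
    refine eq_singleton_iff_unique_mem.2 ⟨hl, fun m hm => ?_⟩
    by_contra hml
    have h1 := card_le_card (sdiff_subset_sdiff (mem_linesIn.1 hm) (subset_refl (linePoints P l)))
    rw [card_linePoints_sdiff (Ne.symm hml)] at h1
    omega
  · right
    obtain ⟨p, hp, r, hr, hpr⟩ := one_lt_card.1 (not_le.1 ht)
    simp only [mem_sdiff, mem_zeroSet, mem_linePoints] at hp hr
    have hm := HasLines.mkLine_ax (L := L) hpr
    set m : L := HasLines.mkLine hpr
    have hlm : l ≠ m := fun e => hp.2 (e ▸ hm.1)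
    have hz := h.zeroSet_eq_union ha0 hlm hl' hp.2 hr.2 hpr hm.1 hm.2 hp.1 hr.1
    refine ⟨?_, ?_⟩
    · rw [hz, union_sdiff_left, card_linePoints_sdiff hlm]
    · have : linesIn L ev a = {l, m} := by
        ext k
        simp only [mem_linesIn, mem_insert, mem_singleton, hz]
        constructor
        · intro hk
          by_contra! hc
          -- A third line in the union would meet `l` and `m` in at most two points altogether, yet
          -- it has at least three.
          have h1 : linePoints P k ⊆
              (linePoints P k ∩ linePoints P l) ∪ (linePoints P k ∩ linePoints P m) := by
            rw [← inter_union_distrib_left]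
            exact subset_inter subset_rfl hk
          have h2 := (card_le_card h1).trans (card_union_le _ _)
          rw [linePoints_inter_card hc.1, linePoints_inter_card hc.2, card_linePoints] at h2
          omega
        · rintro (rfl | rfl)
          · exact subset_union_left
          · exact subset_union_right
      rw [this, card_pair hlm]

variable (ev) in
/-- The nonzero conics containing the line `l` and exactly `t` further points. -/
noncomputable def conicsThrough (l : L) (t : ℕ) : Finset A :=
  {a ∈ (vanishing ev (linePoints P l)).erase 0 | #(zeroSet ev a \ linePoints P l) = t}

theorem zeroSet_zero : zeroSet ev 0 = univ := by
  ext; simp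

theorem card_compl_linePoints (l : L) :
    #(linePoints P l)ᶜ = ProjectivePlane.order P L ^ 2 := by
  rw [card_compl, card_linePoints, ProjectivePlane.card_points P L]
  omega

/-- The zero form contributes the term at `q ^ 2`, the number of points off `l`; `line_type` limits
every other form to `0`, `1` or `q` points off `l`. -/
theorem sum_conicsThrough (h : IsConicSystem L ev) (l : L) (f : ℕ → ℚ) :
    ∑ a ∈ vanishing ev (linePoints P l), f (#(zeroSet ev a \ linePoints P l)) =
      f (ProjectivePlane.order P L ^ 2) + (#(conicsThrough ev l 0) * f 0
        + #(conicsThrough ev l 1) * f 1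
        + #(conicsThrough ev l (ProjectivePlane.order P L)) * f (ProjectivePlane.order P L)) := by
  have hq := ProjectivePlane.one_lt_order P L
  rw [← add_sum_erase _ _ (zero_mem_vanishing ev (linePoints P l)), zeroSet_zero,
    ← compl_eq_univ_sdiff, card_compl_linePoints]
  congr 1
  rw [sum_comp_eq_sum_card_mul _ (fun a => #(zeroSet ev a \ linePoints P l)) f
    {0, 1, ProjectivePlane.order P L}]
  · rw [sum_insert, sum_insert, sum_singleton, add_assoc]
    · rfl
    · simp; omega
    · simp; omega
  · intro a ha
    rw [mem_erase] at ha
    have := h.line_type ha.1 (mem_linesIn.2 (mem_vanishing.1 ha.2))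
    simp only [mem_insert, mem_singleton]
    omega

/-- Three unknowns and three binomial moments of the number of zeros off `l`: the second involves
only the line pairs, the first then gives the conics with one further point, and the total gives the
rest. -/
theorem card_conicsThrough (h : IsConicSystem L ev) (l : L) {q z : ℚ}
    (hq : (ProjectivePlane.order P L : ℚ) = q) (hz : (Fintype.card K : ℚ) = z) :
    (#(conicsThrough ev l 0) : ℚ) = z ^ 3 - 1 - q ^ 2 * (z - 1) * (z - q) - q * (q + 1) * (z - 1) ∧
    (#(conicsThrough ev l 1) : ℚ) = q ^ 2 * (z - 1) * (z - q) ∧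
    (#(conicsThrough ev l (ProjectivePlane.order P L)) : ℚ) = q * (q + 1) * (z - 1) := by
  have hq1 := ProjectivePlane.one_lt_order P L
  have m0 := h.sum_conicsThrough l (fun _ => 1)
  have m1 := h.sum_conicsThrough l (fun t => t)
  have m2 := h.sum_conicsThrough l (fun t => (t.choose 2 : ℕ))
  have e1 := sum_choose_zeroSet ev (linePoints P l) 1
  have e2 := sum_choose_zeroSet ev (linePoints P l) 2
  rw [sum_powersetCard_one, sum_congr (s₁ := (linePoints P l)ᶜ) rfl
    (g := fun _ => Fintype.card K ^ 2)] at e1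
  swap
  · intro p hp
    rw [union_comm, ← insert_eq, h.card_vanishing_line_point (by simpa using hp)]
  rw [sum_congr (s₁ := powersetCard 2 (linePoints P l)ᶜ) rfl (g := fun _ => Fintype.card K)] at e2
  swap
  · intro T hT
    rw [mem_powersetCard] at hT
    obtain ⟨p, r, hpr, rfl⟩ := card_eq_two.1 hT.2
    have hp : p ∉ l := by simpa using hT.1 (mem_insert_self _ _)
    have hr : r ∉ l := by simpa using hT.1 (mem_insert_of_mem (mem_singleton_self r))
    rw [← h.card_vanishing_line_two_points hp hr hpr]
    congr 2
    ext; simp; tauto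
  simp only [sum_const, card_powersetCard, card_compl_linePoints, smul_eq_mul,
    Nat.choose_one_right] at e1 e2
  rw [← Nat.cast_sum] at m1 m2
  rw [e1] at m1
  rw [e2] at m2
  simp only [sum_const, h.card_vanishing_linePoints, Nat.cast_choose_two] at m0 m2
  push_cast at m0 m1 m2
  rw [Nat.cast_choose_two] at m2
  push_cast at m2
  rw [hz, hq] at m1 m2
  simp only [nsmul_eq_mul] at m0
  push_cast at m0
  rw [hz] at m0
  have hq0 : q * (q - 1) ≠ 0 := by
    have : (1 : ℚ) < q := by rw [← hq]; exact_mod_cast hq1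
    exact mul_ne_zero (by linarith) (by linarith)
  set n0 := (#(conicsThrough ev l 0) : ℚ)
  set n1 := (#(conicsThrough ev l 1) : ℚ)
  set nq := (#(conicsThrough ev l (ProjectivePlane.order P L)) : ℚ)
  have hnq : nq = q * (q + 1) * (z - 1) := by
    refine mul_left_cancel₀ hq0 ?_
    linear_combination (-2) * m2
  have hn1 : n1 = q ^ 2 * (z - 1) * (z - q) := by
    rw [hnq] at m1
    linear_combination (-1) * m1
  refine ⟨?_, hn1, hnq⟩
  rw [hn1, hnq] at m0
  linear_combination (-1) * m0

variable (L ev) in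
/-- The nonzero conics which contain a line and have `k` points. -/
noncomputable def lineConics (k : ℕ) : Finset A :=
  {a | a ≠ 0 ∧ (linesIn L ev a).Nonempty ∧ #(zeroSet ev a) = k}

/-- Double counting of pairs of a conic and a line contained in it. -/
theorem sum_card_linesIn (t : ℕ) :
    ∑ a ∈ lineConics L ev (ProjectivePlane.order P L + 1 + t), #(linesIn L ev a)
      = ∑ l : L, #(conicsThrough ev l t) := by
  simp_rw [card_eq_sum_ones]
  refine Finset.sum_comm' ?_
  intro a l
  simp only [lineConics, conicsThrough, mem_filter, mem_univ, true_and, mem_erase, mem_vanishing,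
    mem_linesIn, and_true]
  constructor
  · rintro ⟨⟨h0, -, hc⟩, hl⟩
    rw [card_zeroSet_of_mem (mem_linesIn.2 hl)] at hc
    exact ⟨⟨h0, hl⟩, by omega⟩
  · rintro ⟨⟨h0, hl⟩, ht⟩
    exact ⟨⟨h0, ⟨l, mem_linesIn.2 hl⟩, by rw [card_zeroSet_of_mem (mem_linesIn.2 hl), ht]⟩, hl⟩

theorem card_lineConics (h : IsConicSystem L ev) {q z : ℚ}
    (hq : (ProjectivePlane.order P L : ℚ) = q) (hz : (Fintype.card K : ℚ) = z) :
    (#(lineConics L ev (ProjectivePlane.order P L + 1)) : ℚ) = (q ^ 2 + q + 1) *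
      (z ^ 3 - 1 - q ^ 2 * (z - 1) * (z - q) - q * (q + 1) * (z - 1)) ∧
    (#(lineConics L ev (ProjectivePlane.order P L + 2)) : ℚ) =
      (q ^ 2 + q + 1) * (q ^ 2 * (z - 1) * (z - q)) ∧
    (#(lineConics L ev (2 * ProjectivePlane.order P L + 1)) : ℚ) =
      (q ^ 2 + q + 1) * (q * (q + 1) * (z - 1)) / 2 := by
  have hq1 := ProjectivePlane.one_lt_order P L
  -- Here `c` is the number of lines in each conic of the given type, hence the multiplicity with
  -- which the double count meets it.
  have key : ∀ t c : ℕ, (t = ProjectivePlane.order P L ∧ c = 2 ∨ t ≤ 1 ∧ c = 1) → ∀ x : ℚ,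
      (∀ l : L, (#(conicsThrough ev l t) : ℚ) = x) →
      (#(lineConics L ev (ProjectivePlane.order P L + 1 + t)) : ℚ) * c =
        (q ^ 2 + q + 1) * x := by
    intro t c htc x hx
    have e := sum_card_linesIn (P := P) (L := L) (ev := ev) t
    rw [sum_congr rfl (g := fun _ => c)] at e
    · have e' := congrArg (Nat.cast : ℕ → ℚ) e
      rw [Nat.cast_sum, Nat.cast_sum, sum_congr rfl (g := fun _ => x) (fun l _ => hx l)] at e'
      simp only [sum_const, nsmul_eq_mul, card_univ, ProjectivePlane.card_lines P L] at e'
      push_cast at e'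
      rw [hq] at e'
      exact e'
    · intro a ha
      simp only [lineConics, mem_filter, mem_univ, true_and] at ha
      obtain ⟨h0, ⟨l, hl⟩, hc⟩ := ha
      have h1 := h.line_type h0 hl
      rw [card_zeroSet_of_mem hl] at hc
      omega
  obtain h' := fun l => h.card_conicsThrough l hq hz
  refine ⟨?_, ?_, ?_⟩
  · have := key 0 1 (by omega) _ (fun l => (h' l).1)
    simpa using this
  · have := key 1 1 (by omega) _ (fun l => (h' l).2.1)
    simpa using this
  · have := key (ProjectivePlane.order P L) 2 (by omega) _ (fun l => (h' l).2.2)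
    rw [show 2 * ProjectivePlane.order P L + 1
      = ProjectivePlane.order P L + 1 + ProjectivePlane.order P L by ring, ← this]
    push_cast
    ring

theorem card_zeroSet_of_lines (h : IsConicSystem L ev) {a : A} (ha0 : a ≠ 0)
    (hl : (linesIn L ev a).Nonempty) :
    #(zeroSet ev a) = ProjectivePlane.order P L + 1 ∨
    #(zeroSet ev a) = ProjectivePlane.order P L + 2 ∨
    #(zeroSet ev a) = 2 * ProjectivePlane.order P L + 1 := by
  obtain ⟨l, hl⟩ := hl
  have h1 := h.line_type ha0 hl
  have h2 := card_zeroSet_of_mem hl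
  omega

/-- A set of points meeting every line in at most two points. -/
def IsArc (L : Type*) {P : Type*} [Membership P L] [Fintype P] (T : Finset P) : Prop :=
  ∀ l : L, #(linePoints P l ∩ T) ≤ 2

theorem isArc_of_linesIn (h : IsConicSystem L ev) {a : A} (ha : linesIn L ev a = ∅) :
    IsArc L (zeroSet ev a) := by
  intro l
  by_contra! hc
  have : l ∈ linesIn L ev a :=
    mem_linesIn.2 (h.linePoints_subset inter_subset_left hc inter_subset_right)
  simp [ha] at this

theorem IsArc.subset {S T : Finset P} (hT : IsArc L T) (h : S ⊆ T) : IsArc L S :=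
  fun l => (card_le_card (inter_subset_inter_left h)).trans (hT l)

/-- A line of the conic carries at most two of the five arc points. The other three make the conic a
line pair and lie on its second line, which an arc forbids. -/
theorem linesIn_eq_empty_of_isArc (h : IsConicSystem L ev) {a : A} (ha0 : a ≠ 0) {T : Finset P}
    (hT : IsArc L T) (hc : #T = 5) (ha : T ⊆ zeroSet ev a) : linesIn L ev a = ∅ := by
  rw [eq_empty_iff_forall_notMem]
  intro l hl
  have hl' := mem_linesIn.1 hl
  have h3 : 3 ≤ #(T \ linePoints P l) := by
    have := hT l
    rw [card_sdiff]
    omega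
  have h4 : T \ linePoints P l ⊆ zeroSet ev a \ linePoints P l := sdiff_subset_sdiff ha subset_rfl
  obtain ⟨p, hp, r, hr, hpr⟩ := one_lt_card.1 (show 1 < #(T \ linePoints P l) by omega)
  have hp' := h4 hp
  have hr' := h4 hr
  simp only [mem_sdiff, mem_zeroSet, mem_linePoints] at hp' hr'
  have hm := HasLines.mkLine_ax (L := L) hpr
  set m : L := HasLines.mkLine hpr
  have hlm : l ≠ m := fun e => hp'.2 (e ▸ hm.1)
  have hz := h.zeroSet_eq_union ha0 hlm hl' hp'.2 hr'.2 hpr hm.1 hm.2 hp'.1 hr'.1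
  have h5 : T \ linePoints P l ⊆ linePoints P m ∩ T := by
    intro s hs
    have := h4 hs
    rw [hz] at this
    simp only [mem_sdiff, mem_union, mem_inter] at this hs ⊢
    tauto
  have := (card_le_card h5).trans (hT m)
  omega

/-- Split four of the points into two pairs: the two joining lines miss the fifth, which therefore
imposes a condition independent of the four. -/
theorem card_vanishing_arc (h : IsConicSystem L ev) {T : Finset P}
    (hT : IsArc L T) (hc : #T = 5) : #(vanishing ev T) = Fintype.card K := by
  obtain ⟨e, S, he, rfl, hS⟩ := card_eq_succ.1 hc
  obtain ⟨d, S', hd, rfl, hS'⟩ := card_eq_succ.1 hS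
  obtain ⟨x, y, z, hxy, hxz, hyz, rfl⟩ := card_eq_three.1 hS'
  simp only [mem_insert, mem_singleton, not_or] at hd he
  have hthree : ∀ (l : L) (a b c : P), a ≠ b → a ≠ c → b ≠ c →
      a ∈ insert e (insert d ({x, y, z} : Finset P)) →
      b ∈ insert e (insert d ({x, y, z} : Finset P)) →
      c ∈ insert e (insert d ({x, y, z} : Finset P)) → a ∈ l → b ∈ l → c ∈ l → False := by
    intro l a b c hab hac hbc ha hb hc hal hbl hcl
    have h1 : ({a, b, c} : Finset P) ⊆ linePoints P l ∩ insert e (insert d {x, y, z}) := by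
      intro s hs
      simp only [mem_insert, mem_singleton] at hs
      rw [mem_inter, mem_linePoints]
      rcases hs with rfl | rfl | rfl <;> exact ⟨by assumption, by assumption⟩
    have := (card_le_card h1).trans (hT l)
    rw [card_eq_three.2 ⟨a, b, c, hab, hac, hbc, rfl⟩] at this
    omega
  have hxyl := HasLines.mkLine_ax (L := L) hxy
  set l : L := HasLines.mkLine hxy
  have hzd : z ≠ d := fun e => hd.2.2 e.symm
  have hzdl := HasLines.mkLine_ax (L := L) hzd
  set m : L := HasLines.mkLine hzd
  obtain ⟨a, ha⟩ := h.exists_pair l m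
  have hcard := card_vanishing_insert (ev := ev) (T := insert d {x, y, z}) (p := e) ⟨a, by
    simp [insert_subset_iff, ha, hxyl, hzdl], by
    rw [Ne, ha, not_or]
    exact ⟨fun hel => hthree l x y e hxy (Ne.symm he.2.1) (Ne.symm he.2.2.1) (by simp) (by simp)
      (by simp) hxyl.1 hxyl.2 hel,
      fun hem => hthree m z d e hzd (Ne.symm he.2.2.2) (Ne.symm he.1) (by simp) (by simp)
      (by simp) hzdl.1 hzdl.2 hem⟩⟩
  rw [h.card_vanishing_noncollinear hS] at hcard
  · refine Nat.eq_of_mul_eq_mul_left (Fintype.card_pos (α := K)) ?_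
    rw [← hcard]
    ring
  · rintro ⟨k, hk⟩
    simp only [insert_subset_iff, mem_linePoints, singleton_subset_iff] at hk
    exact hthree k x y z hxy hxz hyz (by simp) (by simp) (by simp) hk.2.1 hk.2.2.1 hk.2.2.2

variable (P L) in
/-- The arcs with five points. -/
noncomputable def fiveArcs : Finset (Finset P) := {T ∈ powersetCard 5 univ | IsArc L T}

variable (L ev) in
/-- The conics which contain no line and have at least five points. -/
noncomputable def arcConics : Finset A := {a | linesIn L ev a = ∅ ∧ 5 ≤ #(zeroSet ev a)}

theorem ne_zero_of_linesIn {a : A} (ha : linesIn L ev a = ∅) : a ≠ 0 := by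
  rintro rfl
  obtain ⟨p⟩ : Nonempty P :=
    Fintype.card_pos_iff.1 (by rw [ProjectivePlane.card_points P L]; omega)
  obtain ⟨l, -⟩ := Nondegenerate.exists_line (L := L) p
  have : l ∈ linesIn L ev 0 := by simp [zeroSet_zero]
  simp [ha] at this

/-- Double counting of pairs of a conic and a five-point arc on it. The number of such arcs does not
depend on `K`, so the count over one field yields it over another. -/
theorem card_arcConics_mul (h : IsConicSystem L ev)
    (harc : ∀ a ∈ arcConics L ev, #(zeroSet ev a) = ProjectivePlane.order P L + 1) :
    #(arcConics L ev) * (ProjectivePlane.order P L + 1).choose 5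
      = #(fiveArcs P L) * (Fintype.card K - 1) := by
  have e : ∑ a ∈ arcConics L ev, #(powersetCard 5 (zeroSet ev a))
      = ∑ T ∈ fiveArcs P L, #((vanishing ev T).erase 0) := by
    simp_rw [card_eq_sum_ones]
    refine Finset.sum_comm' ?_
    intro a T
    simp only [arcConics, fiveArcs, mem_filter, mem_univ, true_and, mem_powersetCard, mem_erase,
      mem_vanishing, subset_univ]
    constructor
    · rintro ⟨⟨h1, h2⟩, h3, h4⟩
      exact ⟨⟨ne_zero_of_linesIn h1, h3⟩, h4, IsArc.subset (h.isArc_of_linesIn h1) h3⟩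
    · rintro ⟨⟨h0, h3⟩, h4, h5⟩
      exact ⟨⟨h.linesIn_eq_empty_of_isArc h0 h5 h4 h3, h4 ▸ card_le_card h3⟩, h3, h4⟩
  rw [sum_congr rfl (g := fun _ => (ProjectivePlane.order P L + 1).choose 5), sum_const,
    sum_congr rfl (g := fun _ => Fintype.card K - 1), sum_const, smul_eq_mul, smul_eq_mul] at e
  · exact e
  · intro T hT
    simp only [fiveArcs, mem_filter, mem_powersetCard] at hT
    rw [card_erase_of_mem (zero_mem_vanishing _ _), h.card_vanishing_arc hT.2 hT.1.2]
  · intro a ha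
    rw [card_powersetCard, harc a ha]

end IsConicSystem

end ConicCounts

/-! ### Moments and the number of conics with a given number of points -/

section ConicTotals

open Finset Configuration
open scoped Classical

theorem cast_choose_three (n : ℕ) : (n.choose 3 : ℚ) = n * (n - 1) * (n - 2) / 6 := by
  induction n with
  | zero => simp
  | succ n ih =>
    rw [Nat.choose_succ_succ' n 2]
    push_cast
    rw [ih, Nat.cast_choose_two]
    ring

theorem cast_choose_four (n : ℕ) : (n.choose 4 : ℚ) = n * (n - 1) * (n - 2) * (n - 3) / 24 := by
  induction n with
  | zero => simp
  | succ n ih =>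
    rw [Nat.choose_succ_succ' n 3]
    push_cast
    rw [ih, cast_choose_three]
    ring

namespace IsConicSystem

variable {P L K A : Type*} [Membership P L] [ProjectivePlane P L] [Fintype P] [Fintype L]
  [Field K] [Fintype K] [AddCommGroup A] [Module K A] [Fintype A] {ev : P → A →ₗ[K] K}

variable (ev) in
/-- The nonzero conics with exactly `k` points. -/
noncomputable def conicsWith (k : ℕ) : Finset A := {a ∈ univ.erase 0 | #(zeroSet ev a) = k}

@[simp] theorem mem_conicsWith {a : A} {k : ℕ} :
    a ∈ conicsWith ev k ↔ a ≠ 0 ∧ #(zeroSet ev a) = k := by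
  simp [conicsWith]

theorem conicsWith_of_ne (harc : ∀ a ∈ arcConics L ev, #(zeroSet ev a) = ProjectivePlane.order P L + 1)
    {k : ℕ} (hk : 5 ≤ k) (hk' : k ≠ ProjectivePlane.order P L + 1) :
    conicsWith ev k = lineConics L ev k := by
  ext a
  simp only [mem_conicsWith, lineConics, mem_filter, mem_univ, true_and]
  refine ⟨fun ⟨h0, hs⟩ => ⟨h0, ?_, hs⟩, fun ⟨h0, _, hs⟩ => ⟨h0, hs⟩⟩
  by_contra hn
  rw [not_nonempty_iff_eq_empty] at hn
  have := harc a (by simp [arcConics, hn]; omega)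
  omega

/-- With `4 ≤ q` a conic having `q + 1` points has at least five, so it either contains a line or
belongs to `arcConics`. -/
theorem card_conicsWith_order (hq : 4 ≤ ProjectivePlane.order P L)
    (harc : ∀ a ∈ arcConics L ev, #(zeroSet ev a) = ProjectivePlane.order P L + 1) :
    #(conicsWith ev (ProjectivePlane.order P L + 1)) =
      #(lineConics L ev (ProjectivePlane.order P L + 1)) + #(arcConics L ev) := by
  rw [← card_union_of_disjoint]
  · congr 1
    ext a
    simp only [mem_conicsWith, lineConics, arcConics, mem_union, mem_filter, mem_univ, true_and]
    constructor
    · rintro ⟨h0, hs⟩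
      rcases eq_empty_or_nonempty (linesIn L ev a) with hn | hn
      · exact Or.inr ⟨hn, by omega⟩
      · exact Or.inl ⟨h0, hn, hs⟩
    · rintro (⟨h0, -, hs⟩ | ⟨hn, hs⟩)
      · exact ⟨h0, hs⟩
      · exact ⟨ne_zero_of_linesIn hn, harc a (by simp [arcConics, hn, hs])⟩
  · rw [disjoint_left]
    intro a ha hb
    simp only [lineConics, arcConics, mem_filter, mem_univ, true_and] at ha hb
    simp [hb.1] at ha

theorem card_zeroSet_mem (h : IsConicSystem L ev)
    (harc : ∀ a ∈ arcConics L ev, #(zeroSet ev a) = ProjectivePlane.order P L + 1) {a : A}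
    (ha : a ≠ 0) : #(zeroSet ev a) ∈ ({0, 1, 2, 3, 4, ProjectivePlane.order P L + 1,
      ProjectivePlane.order P L + 2, 2 * ProjectivePlane.order P L + 1} : Finset ℕ) := by
  simp only [mem_insert, mem_singleton]
  rcases eq_empty_or_nonempty (linesIn L ev a) with hn | hn
  · by_cases h5 : 5 ≤ #(zeroSet ev a)
    · have := harc a (by simp [arcConics, hn, h5])
      omega
    · omega
  · have := h.card_zeroSet_of_lines ha hn
    omega

theorem sum_zeroSet (h : IsConicSystem L ev) (hq : 4 ≤ ProjectivePlane.order P L)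
    (harc : ∀ a ∈ arcConics L ev, #(zeroSet ev a) = ProjectivePlane.order P L + 1) (f : ℕ → ℚ) :
    ∑ a, f (#(zeroSet ev a)) = f (Fintype.card P) + (#(conicsWith ev 0) * f 0
      + #(conicsWith ev 1) * f 1 + #(conicsWith ev 2) * f 2 + #(conicsWith ev 3) * f 3
      + #(conicsWith ev 4) * f 4
      + #(conicsWith ev (ProjectivePlane.order P L + 1)) * f (ProjectivePlane.order P L + 1)
      + #(conicsWith ev (ProjectivePlane.order P L + 2)) * f (ProjectivePlane.order P L + 2)
      + #(conicsWith ev (2 * ProjectivePlane.order P L + 1))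
        * f (2 * ProjectivePlane.order P L + 1)) := by
  rw [← add_sum_erase _ _ (mem_univ 0), zeroSet_zero, card_univ]
  congr 1
  rw [sum_comp_eq_sum_card_mul _ (fun a => #(zeroSet ev a)) f
    {0, 1, 2, 3, 4, ProjectivePlane.order P L + 1,
      ProjectivePlane.order P L + 2, 2 * ProjectivePlane.order P L + 1}]
  -- The eight values are distinct because `q + 1` exceeds `4`.
  · repeat rw [sum_insert (by simp only [mem_insert, mem_singleton]; omega)]
    rw [sum_singleton]
    simp only [← add_assoc]
    rfl
  · intro a ha
    exact h.card_zeroSet_mem harc (mem_erase.1 ha).1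

theorem moment (h : IsConicSystem L ev) {j : ℕ} (hj : j ≤ 3) :
    ∑ a, ((#(zeroSet ev a)).choose j : ℚ)
      = (Fintype.card P).choose j * (Fintype.card K : ℚ) ^ (6 - j) := by
  have e := sum_choose_zeroSet ev ∅ j
  have h0 : vanishing ev ∅ = univ := by ext; simp
  rw [sum_congr (s₁ := powersetCard j (∅ : Finset P)ᶜ) rfl
    (g := fun _ => Fintype.card K ^ (6 - j)), h0] at e
  · simp only [sdiff_empty, sum_const, card_powersetCard, compl_empty, card_univ,
      smul_eq_mul] at e
    exact_mod_cast e
  · intro T hT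
    rw [mem_powersetCard] at hT
    rw [empty_union, h.card_vanishing (by omega), hT.2]

theorem card_collinear_four :
    #{T ∈ powersetCard 4 (univ : Finset P) | ∃ l : L, T ⊆ linePoints P l}
      = Fintype.card L * (ProjectivePlane.order P L + 1).choose 4 := by
  have : {T ∈ powersetCard 4 (univ : Finset P) | ∃ l : L, T ⊆ linePoints P l}
      = univ.biUnion fun l : L => powersetCard 4 (linePoints P l) := by
    ext T
    simp only [mem_filter, mem_powersetCard, mem_biUnion, mem_univ, true_and, subset_univ]
    tauto
  rw [this, card_biUnion]
  · simp [card_powersetCard, card_linePoints]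
  · intro l _ m _ hlm
    change Disjoint _ _
    rw [disjoint_left]
    intro T hT hT'
    rw [mem_powersetCard] at hT hT'
    have := card_le_card (subset_inter hT.1 hT'.1)
    rw [linePoints_inter_card hlm, hT.2] at this
    omega

/-- Four points impose four conditions, except that a collinear quadruple imposes only three; the
last summand is this correction. -/
theorem moment_four (h : IsConicSystem L ev) :
    ∑ a, ((#(zeroSet ev a)).choose 4 : ℚ)
      = (Fintype.card P).choose 4 * (Fintype.card K : ℚ) ^ 2 +
        Fintype.card L * (ProjectivePlane.order P L + 1).choose 4 *
          ((Fintype.card K : ℚ) ^ 3 - (Fintype.card K : ℚ) ^ 2) := by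
  have e := congrArg (Nat.cast : ℕ → ℚ) (sum_choose_zeroSet ev ∅ 4)
  have h0 : vanishing ev ∅ = univ := by ext; simp
  rw [h0, Nat.cast_sum, Nat.cast_sum, sum_congr (s₁ := powersetCard 4 (∅ : Finset P)ᶜ) rfl
    (g := fun T => (Fintype.card K : ℚ) ^ 2 + if (∃ l : L, T ⊆ linePoints P l) then
      (Fintype.card K : ℚ) ^ 3 - (Fintype.card K : ℚ) ^ 2 else 0)] at e
  · rw [sum_add_distrib, ← sum_filter, sum_const, sum_const, compl_empty, card_powersetCard,
      card_collinear_four] at e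
    simpa using e
  · intro T hT
    rw [mem_powersetCard] at hT
    rw [empty_union]
    split_ifs with hc
    · obtain ⟨l, hl⟩ := hc
      rw [h.card_vanishing_collinear hl (by omega)]
      push_cast; ring
    · rw [h.card_vanishing_noncollinear hT.2 hc]
      push_cast; ring

/-- The number of conics without rational lines over the base field. -/
theorem card_arcConics_base (h : IsConicSystem L ev) {q : ℚ}
    (hq : (ProjectivePlane.order P L : ℚ) = q) (hq4 : 4 ≤ ProjectivePlane.order P L)
    (hK : Fintype.card K = ProjectivePlane.order P L)
    (harc : ∀ a, linesIn L ev a = ∅ → 2 ≤ #(zeroSet ev a) →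
      #(zeroSet ev a) = ProjectivePlane.order P L + 1) :
    (#(arcConics L ev) : ℚ) = (q ^ 5 - q ^ 2) * (q - 1) := by
  have harc' : ∀ a ∈ arcConics L ev, #(zeroSet ev a) = ProjectivePlane.order P L + 1 := by
    intro a ha
    simp only [arcConics, mem_filter, mem_univ, true_and] at ha
    exact harc a ha.1 (by omega)
  have hz : (Fintype.card K : ℚ) = q := by rw [hK, hq]
  have hempty : ∀ k, 2 ≤ k → k ≤ 4 → conicsWith ev k = ∅ := by
    intro k hk hk'
    rw [eq_empty_iff_forall_notMem]
    intro a ha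
    rw [mem_conicsWith] at ha
    rcases eq_empty_or_nonempty (linesIn L ev a) with hn | hn
    · have := harc a hn (by omega)
      omega
    · have := h.card_zeroSet_of_lines ha.1 hn
      omega
  -- The third moment kills the counts for `0`, `1` and `2` points, those for `3` and `4` are zero
  -- over the base field, and those of conics with lines are known: only `arcConics` remains.
  have e := h.moment (j := 3) le_rfl
  rw [h.sum_zeroSet hq4 harc' fun s => (s.choose 3 : ℕ), card_conicsWith_order hq4 harc',
    conicsWith_of_ne harc' (k := ProjectivePlane.order P L + 2) (by omega) (by omega),
    conicsWith_of_ne harc' (k := 2 * ProjectivePlane.order P L + 1) (by omega) (by omega),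
    hempty 3 (by omega) (by omega), hempty 4 (by omega) (by omega)] at e
  obtain ⟨l0, l1, l2⟩ := h.card_lineConics hq hz
  simp only [cast_choose_three, ProjectivePlane.card_points P L, card_empty] at e
  push_cast at e
  rw [l0, l1, l2, hz, hq] at e
  have hq0 : (q + 1) * q * (q - 1) ≠ 0 := by
    have : (4 : ℚ) ≤ q := by rw [← hq]; exact_mod_cast hq4
    exact mul_ne_zero (mul_ne_zero (by linarith) (by linarith)) (by linarith)
  refine mul_left_cancel₀ hq0 ?_
  linear_combination 6 * e

/-- The number of five-point arcs is eliminated between the double counts over `K₀` and `K`.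
Cancelling `(q + 1).choose 5` needs `4 ≤ q`. -/
theorem card_arcConics (h : IsConicSystem L ev) {K₀ A₀ : Type*} [Field K₀] [Fintype K₀]
    [AddCommGroup A₀] [Module K₀ A₀] [Fintype A₀] {ev₀ : P → A₀ →ₗ[K₀] K₀}
    (h₀ : IsConicSystem L ev₀) {q z : ℚ}
    (hq : (ProjectivePlane.order P L : ℚ) = q) (hq4 : 4 ≤ ProjectivePlane.order P L)
    (hK₀ : Fintype.card K₀ = ProjectivePlane.order P L) (hz : (Fintype.card K : ℚ) = z)
    (harc₀ : ∀ a, linesIn L ev₀ a = ∅ → 2 ≤ #(zeroSet ev₀ a) →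
      #(zeroSet ev₀ a) = ProjectivePlane.order P L + 1)
    (harc : ∀ a ∈ arcConics L ev, #(zeroSet ev a) = ProjectivePlane.order P L + 1) :
    (#(arcConics L ev) : ℚ) = (q ^ 5 - q ^ 2) * (z - 1) := by
  have e₀ := congrArg (Nat.cast : ℕ → ℚ) (h₀.card_arcConics_mul fun a ha => by
    simp only [arcConics, mem_filter, mem_univ, true_and] at ha
    exact harc₀ a ha.1 (by omega))
  have e := congrArg (Nat.cast : ℕ → ℚ) (h.card_arcConics_mul harc)
  rw [Nat.cast_mul, Nat.cast_mul, Nat.cast_sub Fintype.card_pos, Nat.cast_one] at e e₀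
  rw [h₀.card_arcConics_base hq hq4 hK₀ harc₀, hK₀, hq] at e₀
  rw [hz] at e
  have hq1 : (4 : ℚ) ≤ q := by rw [← hq]; exact_mod_cast hq4
  have hc : ((ProjectivePlane.order P L + 1).choose 5 : ℚ) ≠ 0 := by
    exact_mod_cast (Nat.choose_pos (by omega)).ne'
  have hf : (#(fiveArcs P L) : ℚ)
      = (q ^ 5 - q ^ 2) * ((ProjectivePlane.order P L + 1).choose 5 : ℚ) := by
    refine mul_right_cancel₀ (b := q - 1) (by linarith) ?_
    linear_combination (-1) * e₀
  rw [hf] at e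
  refine mul_right_cancel₀ hc ?_
  linear_combination e

/-- The numbers of conics with a given number of points. -/
theorem card_conicsWith (h : IsConicSystem L ev) {q z : ℚ}
    (hq : (ProjectivePlane.order P L : ℚ) = q) (hq4 : 4 ≤ ProjectivePlane.order P L)
    (hz : (Fintype.card K : ℚ) = z)
    (harc : ∀ a ∈ arcConics L ev, #(zeroSet ev a) = ProjectivePlane.order P L + 1)
    (hnarc : (#(arcConics L ev) : ℚ) = (q ^ 5 - q ^ 2) * (z - 1)) :
    (#(conicsWith ev (2 * ProjectivePlane.order P L + 1)) : ℚ)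
      = (q ^ 2 + q + 1) * (q ^ 2 + q) / 2 * (z - 1) ∧
    (#(conicsWith ev (ProjectivePlane.order P L + 2)) : ℚ)
      = (q ^ 2 + q + 1) * q ^ 2 * (z - q) * (z - 1) ∧
    (#(conicsWith ev (ProjectivePlane.order P L + 1)) : ℚ)
      = (q ^ 2 + q + 1) * (z - 1) *
          (z ^ 2 - (q ^ 2 - 1) * z + (2 * q ^ 3 - 2 * q ^ 2 - q + 1)) ∧
    (#(conicsWith ev 4) : ℚ)
      = (q ^ 2 + q + 1) * (q + 1) * q ^ 3 * (q - 1) ^ 2 / 24 * (z - q) * (z - 1) ∧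
    (#(conicsWith ev 3) : ℚ)
      = (q ^ 2 + q + 1) * (q + 1) * q ^ 3 / 6 * (z - 1) * (z - q) * (z - (q ^ 2 - 3 * q + 3)) ∧
    (#(conicsWith ev 2) : ℚ)
      = (q ^ 2 + q + 1) * (q + 1) * q / 4 * (z - 1) * (z - q) *
          (2 * z ^ 2 - 2 * (q ^ 2 - q) * z + (q ^ 4 - 4 * q ^ 3 + 7 * q ^ 2 - 4 * q)) ∧
    (#(conicsWith ev 1) : ℚ)
      = (q ^ 2 + q + 1) / 6 * (z - 1) *
          (6 * z ^ 4 - (6 * q ^ 2 + 6 * q - 6) * z ^ 3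
            + (3 * q ^ 4 + 3 * q ^ 3 - 6 * q) * z ^ 2
            - (q ^ 6 - q ^ 5 + 5 * q ^ 4 - 5 * q ^ 3 - 6 * q ^ 2 + 6 * q) * z
            + (q ^ 7 - 4 * q ^ 6 + 8 * q ^ 5 - 5 * q ^ 4 - 6 * q ^ 3 + 9 * q ^ 2 - 3 * q)) ∧
    (#(conicsWith ev 0) : ℚ)
      = 1 / 24 * (z - 1) * (z - q) *
          (24 * z ^ 4 - 24 * q ^ 2 * z ^ 3 + (12 * q ^ 4 - 12 * q) * z ^ 2
            - (4 * q ^ 6 - 4 * q ^ 5 + 8 * q ^ 4 - 20 * q ^ 3 + 12 * q ^ 2) * z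
            + (q ^ 8 - 4 * q ^ 7 + 11 * q ^ 6 - 17 * q ^ 5 + 12 * q ^ 4 - 3 * q ^ 3)) := by
  obtain ⟨l0, l1, l2⟩ := h.card_lineConics hq hz
  have m0 := h.moment (j := 0) (by omega)
  have m1 := h.moment (j := 1) (by omega)
  have m2 := h.moment (j := 2) (by omega)
  have m3 := h.moment (j := 3) (by omega)
  have m4 := h.moment_four
  rw [h.sum_zeroSet hq4 harc fun s => (s.choose 0 : ℕ)] at m0
  rw [h.sum_zeroSet hq4 harc fun s => (s.choose 1 : ℕ)] at m1
  rw [h.sum_zeroSet hq4 harc fun s => (s.choose 2 : ℕ)] at m2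
  rw [h.sum_zeroSet hq4 harc fun s => (s.choose 3 : ℕ)] at m3
  rw [h.sum_zeroSet hq4 harc fun s => (s.choose 4 : ℕ)] at m4
  have c0 : (#(conicsWith ev (ProjectivePlane.order P L + 1)) : ℚ)
      = (q ^ 2 + q + 1) * (z - 1) *
          (z ^ 2 - (q ^ 2 - 1) * z + (2 * q ^ 3 - 2 * q ^ 2 - q + 1)) := by
    rw [card_conicsWith_order hq4 harc, Nat.cast_add, l0, hnarc]
    ring
  have c1 : (#(conicsWith ev (ProjectivePlane.order P L + 2)) : ℚ)
      = (q ^ 2 + q + 1) * q ^ 2 * (z - q) * (z - 1) := by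
    rw [conicsWith_of_ne harc (by omega) (by omega), l1]
    ring
  have c2 : (#(conicsWith ev (2 * ProjectivePlane.order P L + 1)) : ℚ)
      = (q ^ 2 + q + 1) * (q ^ 2 + q) / 2 * (z - 1) := by
    rw [conicsWith_of_ne harc (by omega) (by omega), l2]
    ring
  simp only [cast_choose_three, cast_choose_four, Nat.cast_choose_two, Nat.choose_one_right,
    Nat.choose_zero_right, ProjectivePlane.card_points P L, ProjectivePlane.card_lines P L]
    at m0 m1 m2 m3 m4
  push_cast at m0 m1 m2 m3 m4
  rw [c0, c1, c2, hz, hq] at m1 m2 m3 m4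
  rw [c0, c1, c2, hz] at m0
  refine ⟨c2, c1, c0, ?_⟩
  clear c0 c1 c2 l0 l1 l2 hnarc
  generalize (#(conicsWith ev 0) : ℚ) = n0 at *
  generalize (#(conicsWith ev 1) : ℚ) = n1 at *
  generalize (#(conicsWith ev 2) : ℚ) = n2 at *
  generalize (#(conicsWith ev 3) : ℚ) = n3 at *
  generalize (#(conicsWith ev 4) : ℚ) = n4 at *
  -- The system is triangular; the coefficients are those of binomial inversion, `(-1) ^ (i - j) *
  -- i.choose j`.
  refine ⟨?_, ?_, ?_, ?_, ?_⟩
  · linear_combination m4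
  · linear_combination m3 - 4 * m4
  · linear_combination m2 - 3 * m3 + 6 * m4
  · linear_combination m1 - 2 * m2 + 3 * m3 - 4 * m4
  · linear_combination m0 - m1 + m2 - m3 + m4

end IsConicSystem

end ConicTotals

/-! ### Quadratic forms over an extension field at the rational points of the plane -/

section PlaneConics

open Finset Configuration Projectivization Matrix
open scoped Classical

variable {F : Type*} [Field F]

variable (K : Type*) [Field K] [Algebra F K]

/-- Evaluation of the quadratic form over `K` with given coefficients at a vector over `F`. -/
noncomputable def conicForm (v : Fin 3 → F) : (Fin 6 → K) →ₗ[K] K :=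
  ∑ i, algebraMap F K (veroneseVec v i) • LinearMap.proj i

variable {K}

theorem conicForm_eq_sum (v : Fin 3 → F) (a : Fin 6 → K) :
    conicForm K v a = ∑ i, a i * algebraMap F K (veroneseVec v i) := by
  simp [conicForm, Algebra.smul_def, mul_comm]

theorem conicForm_apply (v : Fin 3 → F) (a : Fin 6 → K) :
    conicForm K v a = a 0 * algebraMap F K (v 0) ^ 2
      + a 1 * (algebraMap F K (v 0) * algebraMap F K (v 1))
      + a 2 * (algebraMap F K (v 0) * algebraMap F K (v 2)) + a 3 * algebraMap F K (v 1) ^ 2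
      + a 4 * (algebraMap F K (v 1) * algebraMap F K (v 2)) + a 5 * algebraMap F K (v 2) ^ 2 := by
  rw [conicForm_eq_sum, Fin.sum_univ_six]
  simp [veroneseVec]

theorem conicForm_smul (c : F) (v : Fin 3 → F) (a : Fin 6 → K) :
    conicForm K (c • v) a = algebraMap F K c ^ 2 * conicForm K v a := by
  simp only [conicForm_apply, Pi.smul_apply, smul_eq_mul, map_mul]
  ring

theorem conicForm_algebraMap (v : Fin 3 → F) (a : Fin 6 → F) :
    conicForm K v (fun i => algebraMap F K (a i)) = algebraMap F K (conicForm F v a) := by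
  simp [conicForm_eq_sum]

/-- The cross term is the polar form, written without division by two so that characteristic two is
included. -/
theorem conicForm_comb (x y : F) (u v : Fin 3 → F) (a : Fin 6 → K) :
    conicForm K (x • u + y • v) a = algebraMap F K x ^ 2 * conicForm K u a
      + algebraMap F K y ^ 2 * conicForm K v a + algebraMap F K x * algebraMap F K y *
        (conicForm K (u + v) a - conicForm K u a - conicForm K v a) := by
  simp only [conicForm_apply, Pi.add_apply, Pi.smul_apply, smul_eq_mul, map_mul, map_add]
  ring

variable (K) in
/-- Evaluation of conics over `K` at a rational point. -/
noncomputable def conicEval (p : ℙ F (Fin 3 → F)) : (Fin 6 → K) →ₗ[K] K := conicForm K p.rep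

theorem conicEval_eq_zero_iff {p : ℙ F (Fin 3 → F)} {v : Fin 3 → F} (hv : v ≠ 0)
    (hp : Projectivization.mk F v hv = p) (a : Fin 6 → K) :
    conicEval K p a = 0 ↔ conicForm K v a = 0 := by
  obtain ⟨c, hc⟩ := exists_smul_eq_mk_rep F v hv
  rw [conicEval, ← hp, ← hc, Units.smul_def, conicForm_smul]
  simp

theorem mem_line_iff {p l : ℙ F (Fin 3 → F)} : p ∈ l ↔ p.rep ⬝ᵥ l.rep = 0 := by
  rw [ofField.mem_iff, ← orthogonal_mk p.rep_nonzero l.rep_nonzero, mk_rep, mk_rep]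

theorem eq_of_smul_rep {p r : ℙ F (Fin 3 → F)} {c : F} (h : p.rep = c • r.rep) : p = r := by
  rw [← mk_rep p, ← mk_rep r, mk_eq_mk_iff']
  exact ⟨c, h.symm⟩

theorem linearIndependent_rep {p r : ℙ F (Fin 3 → F)} (h : p ≠ r) :
    LinearIndependent F ![p.rep, r.rep] := by
  rw [LinearIndependent.pair_iff' p.rep_nonzero]
  intro c hc
  exact h (eq_of_smul_rep hc.symm).symm

/-- The vectors on the line form the kernel of a nonzero functional on a three-dimensional space,
which two distinct points must span. -/
theorem exists_comb_of_mem {l p₁ p₂ p : ℙ F (Fin 3 → F)} (h₁ : p₁ ∈ l) (h₂ : p₂ ∈ l) (h : p ∈ l)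
    (hne : p₁ ≠ p₂) : ∃ x y : F, p.rep = x • p₁.rep + y • p₂.rep := by
  rw [mem_line_iff] at h₁ h₂ h
  let f : (Fin 3 → F) →ₗ[F] F :=
    { toFun := fun w => w ⬝ᵥ l.rep
      map_add' := fun v w => add_dotProduct v w _
      map_smul' := fun c w => smul_dotProduct c w _ }
  have hf : ∀ w, f w = w ⬝ᵥ l.rep := fun w => rfl
  have hf0 : f ≠ 0 := by
    intro h0
    refine l.rep_nonzero (dotProduct_eq_zero_iff.1 fun w => ?_)
    rw [dotProduct_comm, ← hf, h0, LinearMap.zero_apply]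
  have hle : Submodule.span F {p₁.rep, p₂.rep} ≤ LinearMap.ker f := by
    rw [Submodule.span_le]
    rintro w (rfl | rfl) <;> simp [hf, h₁, h₂]
  have hs : Module.finrank F (Submodule.span F {p₁.rep, p₂.rep}) = 2 := by
    have := finrank_span_eq_card (linearIndependent_rep hne)
    rwa [Matrix.range_cons_cons_empty, Fintype.card_fin] at this
  have hk : Module.finrank F (LinearMap.ker f) ≤ 2 := by
    have h1 := LinearMap.finrank_range_add_finrank_ker f
    have h2 : 0 < Module.finrank F (LinearMap.range f) := by
      rw [Module.finrank_pos_iff_exists_ne_zero]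
      obtain ⟨w, hw⟩ : ∃ w, f w ≠ 0 := by
        by_contra! hc
        exact hf0 (LinearMap.ext hc)
      exact ⟨⟨f w, w, rfl⟩, by simpa [Subtype.ext_iff] using hw⟩
    rw [Module.finrank_fin_fun] at h1
    omega
  have hp : p.rep ∈ Submodule.span F {p₁.rep, p₂.rep} := by
    rw [Submodule.eq_of_le_of_finrank_le hle (hs ▸ hk)]
    simp [hf, h]
  obtain ⟨x, y, hxy⟩ := Submodule.mem_span_pair.1 hp
  exact ⟨x, y, hxy.symm⟩

theorem order_projectivization [Fintype F] :
    ProjectivePlane.order (ℙ F (Fin 3 → F)) (ℙ F (Fin 3 → F)) = Fintype.card F := by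
  have : Fintype (ℙ F (Fin 3 → F)) := Fintype.ofFinite _
  have h1 := ProjectivePlane.card_points (ℙ F (Fin 3 → F)) (ℙ F (Fin 3 → F))
  have h2 := card_of_finrank F (Fin 3 → F) (n := 3) (by simp)
  rw [Nat.card_eq_fintype_card, h1, Nat.card_eq_fintype_card] at h2
  simp only [sum_range_succ, range_zero, sum_empty] at h2
  nlinarith

/-- Line pairs come from products of two linear forms. Restricted to a line, a form with two zeros
is a multiple of `x * y` in the coordinates they give, and a third zero makes it vanish. -/
theorem isConicSystem_conicEval :
    IsConicSystem (ℙ F (Fin 3 → F)) (conicEval K (F := F)) where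
  exists_pair l m := by
    let a : Fin 6 → F := ![l.rep 0 * m.rep 0, l.rep 0 * m.rep 1 + l.rep 1 * m.rep 0,
      l.rep 0 * m.rep 2 + l.rep 2 * m.rep 0, l.rep 1 * m.rep 1,
      l.rep 1 * m.rep 2 + l.rep 2 * m.rep 1, l.rep 2 * m.rep 2]
    refine ⟨fun i => algebraMap F K (a i), fun p => ?_⟩
    rw [mem_line_iff, mem_line_iff, ← mul_eq_zero, conicEval, conicForm_algebraMap,
      map_eq_zero_iff _ (algebraMap F K).injective, conicForm_apply]
    refine Eq.congr ?_ rfl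
    simp [a, dotProduct, Fin.sum_univ_three]
    ring
  line l p₁ p₂ p₃ h₁ h₂ h₃ h₁₂ h₁₃ h₂₃ a e₁ e₂ e₃ p hp := by
    obtain ⟨x, y, hxy⟩ := exists_comb_of_mem h₁ h₂ hp h₁₂
    obtain ⟨s, t, hst⟩ := exists_comb_of_mem h₁ h₂ h₃ h₁₂
    have hs : s ≠ 0 := by
      rintro rfl
      exact h₂₃ (eq_of_smul_rep (by simpa using hst)).symm
    have ht : t ≠ 0 := by
      rintro rfl
      exact h₁₃ (eq_of_smul_rep (by simpa using hst)).symm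
    rw [conicEval] at e₁ e₂ e₃ ⊢
    rw [hst, conicForm_comb, e₁, e₂] at e₃
    rw [hxy, conicForm_comb, e₁, e₂]
    simp only [mul_zero, zero_add, sub_zero, mul_eq_zero, map_eq_zero, hs, ht, false_or] at e₃ ⊢
    exact Or.inr e₃
  card := by rw [Nat.card_fun, Nat.card_fin]

variable [Fintype F] [Fintype (ℙ F (Fin 3 → F))]

/-- The coefficients of the polar form of a vector. -/
def polarVec (a : Fin 6 → F) (u : Fin 3 → F) : Fin 3 → F :=
  ![2 * a 0 * u 0 + a 1 * u 1 + a 2 * u 2, a 1 * u 0 + 2 * a 3 * u 1 + a 4 * u 2,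
    a 2 * u 0 + a 4 * u 1 + 2 * a 5 * u 2]

theorem conicForm_comb_polarVec (x y : F) (u v : Fin 3 → F) (a : Fin 6 → F) :
    conicForm F (x • u + y • v) a = x ^ 2 * conicForm F u a
      + y ^ 2 * conicForm F v a + x * y * (v ⬝ᵥ polarVec a u) := by
  simp [conicForm_apply, dotProduct, Fin.sum_univ_three, polarVec]
  ring

theorem polarVec_self (u : Fin 3 → F) (a : Fin 6 → F) :
    u ⬝ᵥ polarVec a u = 2 * conicForm F u a := by
  simp [conicForm_apply, dotProduct, Fin.sum_univ_three, polarVec]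
  ring

open IsConicSystem

/-- A conic over `F` which contains no line and has at least two rational points has `q + 1`
rational points. -/
theorem card_zeroSet_of_linesIn_eq_empty {a : Fin 6 → F}
    (ha : linesIn (ℙ F (Fin 3 → F)) (conicEval F (F := F)) a = ∅)
    (h2 : 2 ≤ #(zeroSet (conicEval F (F := F)) a)) :
    #(zeroSet (conicEval F (F := F)) a) = Fintype.card F + 1 := by
  have hsys := isConicSystem_conicEval (F := F) (K := F)
  obtain ⟨p, hp, r₀, hr₀, hpr₀⟩ := one_lt_card.1 h2
  have hpa : conicForm F p.rep a = 0 := (mem_zeroSet (ev := conicEval F)).1 hp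
  -- The polar vector of `p` cuts out the tangent at `p`. A second zero `r` on it would make the
  -- form vanish on the whole line `pr`.
  have hnonpolar : ∀ r ∈ zeroSet (conicEval F (F := F)) a, p ≠ r →
      r.rep ⬝ᵥ polarVec a p.rep ≠ 0 := by
    intro r hr hpr h0
    have hra : conicForm F r.rep a = 0 := (mem_zeroSet (ev := conicEval F)).1 hr
    have hm := HasLines.mkLine_ax (L := ℙ F (Fin 3 → F)) hpr
    set m := HasLines.mkLine (L := ℙ F (Fin 3 → F)) hpr
    have : m ∈ linesIn (ℙ F (Fin 3 → F)) (conicEval F (F := F)) a := by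
      rw [mem_linesIn]
      intro s hs
      obtain ⟨x, y, hxy⟩ := exists_comb_of_mem hm.1 hm.2 (mem_linePoints.1 hs) hpr
      rw [mem_zeroSet, conicEval, hxy, conicForm_comb_polarVec, hpa, hra, h0]
      simp
    simp [ha] at this
  have hb : polarVec a p.rep ≠ 0 := fun h0 => hnonpolar r₀ hr₀ hpr₀ (by simp [h0])
  set b : ℙ F (Fin 3 → F) := Projectivization.mk F (polarVec a p.rep) hb with hbdef
  have hmem : ∀ s : ℙ F (Fin 3 → F), s ∈ b ↔ s.rep ⬝ᵥ polarVec a p.rep = 0 := by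
    intro s
    rw [ofField.mem_iff, ← orthogonal_mk s.rep_nonzero hb, mk_rep]
  have hpb : p ∈ b := by rw [hmem, polarVec_self, hpa, mul_zero]
  have hlines : #({l | p ∈ l} : Finset (ℙ F (Fin 3 → F))) = Fintype.card F + 1 := by
    rw [← order_projectivization (F := F), ← ProjectivePlane.lineCount_eq
      (P := ℙ F (Fin 3 → F)) (L := ℙ F (Fin 3 → F)) p, lineCount, Nat.card_eq_fintype_card,
      Fintype.card_subtype]
  -- Projection from `p`: the other points of the conic correspond to the lines through `p` other
  -- than the tangent `b`.
  have key : #((zeroSet (conicEval F (F := F)) a).erase p)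
      = #(({l | p ∈ l} : Finset (ℙ F (Fin 3 → F))).erase b) := by
    refine Finset.card_bij (fun r hr => HasLines.mkLine (L := ℙ F (Fin 3 → F))
      (Ne.symm (mem_erase.1 hr).1)) ?_ ?_ ?_
    · intro r hr
      have hr' := mem_erase.1 hr
      have hm := HasLines.mkLine_ax (L := ℙ F (Fin 3 → F)) (Ne.symm hr'.1)
      rw [mem_erase, mem_filter]
      refine ⟨fun e => ?_, mem_univ _, hm.1⟩
      exact hnonpolar r hr'.2 (Ne.symm hr'.1) ((hmem r).1 (e ▸ hm.2))
    · intro r hr s hs hrs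
      have hr' := mem_erase.1 hr
      have hs' := mem_erase.1 hs
      have hm := HasLines.mkLine_ax (L := ℙ F (Fin 3 → F)) (Ne.symm hr'.1)
      have hm' := HasLines.mkLine_ax (L := ℙ F (Fin 3 → F)) (Ne.symm hs'.1)
      rw [← hrs] at hm'
      by_contra hne
      have harc := hsys.isArc_of_linesIn ha (HasLines.mkLine (Ne.symm hr'.1))
      have hsub : ({p, r, s} : Finset _) ⊆
          linePoints _ (HasLines.mkLine (L := ℙ F (Fin 3 → F)) (Ne.symm hr'.1)) ∩
            zeroSet (conicEval F (F := F)) a := by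
        intro t ht
        simp only [mem_insert, mem_singleton] at ht
        rw [mem_inter, mem_linePoints]
        rcases ht with rfl | rfl | rfl
        exacts [⟨hm.1, hp⟩, ⟨hm.2, hr'.2⟩, ⟨hm'.2, hs'.2⟩]
      have := (card_le_card hsub).trans harc
      rw [card_eq_three.2 ⟨p, r, s, Ne.symm hr'.1, Ne.symm hs'.1, hne, rfl⟩] at this
      omega
    · intro m hm
      rw [mem_erase, mem_filter] at hm
      obtain ⟨hmb, -, hpm⟩ := hm
      obtain ⟨v, hv, hvp⟩ : ∃ v ∈ linePoints (ℙ F (Fin 3 → F)) m, v ≠ p := by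
        refine exists_mem_ne ?_ p
        have := three_le_card_linePoints (P := ℙ F (Fin 3 → F)) m
        omega
      rw [mem_linePoints] at hv
      have hvb : v.rep ⬝ᵥ polarVec a p.rep ≠ 0 := by
        rw [Ne, ← hmem]
        intro hvb
        exact hmb ((Nondegenerate.eq_or_eq hv hpm hvb hpb).resolve_left hvp)
      have hw : ∀ c : F, conicForm F v.rep a • p.rep + (-(v.rep ⬝ᵥ polarVec a p.rep)) • v.rep
          ≠ c • p.rep := by
        intro c hc
        refine hvp (eq_of_smul_rep (c := (v.rep ⬝ᵥ polarVec a p.rep)⁻¹ *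
          (conicForm F v.rep a - c)) ?_)
        rw [mul_smul, sub_smul, ← hc, eq_inv_smul_iff₀ hvb]
        module
      -- On `x • p + y • v` the form is `y * (y * Q v + x * B)`, where `B` is the polar value of `p`
      -- and `v`; its second zero is `x = Q v`, `y = -B`.
      set w := conicForm F v.rep a • p.rep + (-(v.rep ⬝ᵥ polarVec a p.rep)) • v.rep with hwdef
      have hw0 : w ≠ 0 := by simpa using hw 0
      have hwp : Projectivization.mk F w hw0 ≠ p := by
        intro e
        rw [← mk_rep p, mk_eq_mk_iff'] at e
        obtain ⟨c, hc⟩ := e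
        exact hw c hc.symm
      have hwz : Projectivization.mk F w hw0 ∈ zeroSet (conicEval F (F := F)) a := by
        rw [mem_zeroSet, conicEval_eq_zero_iff hw0 rfl, hwdef, conicForm_comb_polarVec, hpa]
        ring
      have hwm : Projectivization.mk F w hw0 ∈ m := by
        rw [ofField.mem_iff, ← mk_rep m, orthogonal_mk hw0 m.rep_nonzero, hwdef, add_dotProduct,
          smul_dotProduct, smul_dotProduct, mem_line_iff.1 hpm, mem_line_iff.1 hv]
        simp
      refine ⟨_, mem_erase.2 ⟨hwp, hwz⟩, ?_⟩
      have hax := HasLines.mkLine_ax (L := ℙ F (Fin 3 → F)) (Ne.symm hwp)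
      exact (Nondegenerate.eq_or_eq hax.1 hax.2 hpm hwm).resolve_left (Ne.symm hwp)
  rw [card_erase_of_mem hp, card_erase_of_mem (by simp [hpb]), hlines] at key
  omega

variable [Fintype K]

/-- A conic over an extension field without rational lines but with at least five rational points
is defined over the base field. -/
theorem card_zeroSet_of_mem_arcConics {a : Fin 6 → K}
    (ha : a ∈ arcConics (ℙ F (Fin 3 → F)) (conicEval K (F := F))) :
    #(zeroSet (conicEval K (F := F)) a) = Fintype.card F + 1 := by
  have hsys := isConicSystem_conicEval (F := F) (K := K)
  have hsys₀ := isConicSystem_conicEval (F := F) (K := F)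
  simp only [arcConics, mem_filter, mem_univ, true_and] at ha
  obtain ⟨hal, ha5⟩ := ha
  obtain ⟨T, hT, hT5⟩ := exists_subset_card_eq ha5
  have harc := (hsys.isArc_of_linesIn hal).subset hT
  obtain ⟨a₀, ha₀, ha₀0⟩ : ∃ a₀ ∈ vanishing (conicEval F (F := F)) T, a₀ ≠ 0 := by
    refine exists_mem_ne ?_ 0
    rw [hsys₀.card_vanishing_arc harc hT5]
    exact Fintype.one_lt_card
  rw [mem_vanishing] at ha₀
  have hz : zeroSet (conicEval K (F := F)) (fun i => algebraMap F K (a₀ i))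
      = zeroSet (conicEval F (F := F)) a₀ := by
    ext p
    simp [conicEval, conicForm_algebraMap]
  have hinj : Function.Injective fun c : K => c • fun i => algebraMap F K (a₀ i) := by
    refine smul_left_injective K fun h0 => ha₀0 (funext fun i => ?_)
    simpa using congrFun h0 i
  -- The multiples of `a₀` are `|K|` forms vanishing on `T`, hence all of them; so `a` is a multiple
  -- of a form over `F`.
  have hmul : univ.image (fun c : K => c • fun i => algebraMap F K (a₀ i))
      = vanishing (conicEval K (F := F)) T := by
    refine eq_of_subset_of_card_le ?_ ?_
    · intro x hx
      obtain ⟨c, -, rfl⟩ := mem_image.1 hx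
      rw [mem_vanishing]
      intro p hp
      have h1 : conicEval K p (fun i => algebraMap F K (a₀ i)) = 0 :=
        mem_zeroSet.1 (hz ▸ ha₀ hp)
      rw [mem_zeroSet, map_smul, h1, smul_zero]
    · rw [card_image_of_injective _ hinj, hsys.card_vanishing_arc harc hT5, card_univ]
  have hamem : a ∈ vanishing (conicEval K (F := F)) T := mem_vanishing.2 hT
  rw [← hmul, mem_image] at hamem
  obtain ⟨c, -, rfl⟩ := hamem
  have hc : c ≠ 0 := by
    rintro rfl
    exact ne_zero_of_linesIn hal (zero_smul _ _)
  rw [zeroSet_smul _ _ hc, hz] at ha5 ⊢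
  refine card_zeroSet_of_linesIn_eq_empty ?_ (by omega)
  exact hsys₀.linesIn_eq_empty_of_isArc ha₀0 harc hT5 ha₀

end PlaneConics

/-! ### From words of the Veronese code to conics -/

section VeroneseCode

open Finset Configuration Projectivization
open scoped Classical

/-- Proportional Veronese vectors lie on the same hyperplanes, whereas some conic through one of two
distinct points misses the other. -/
theorem veroneseMap_injective (F : Type u) [Field F] [Finite F] :
    Function.Injective (veroneseMap F) := by
  have := Fintype.ofFinite F
  have := Fintype.ofFinite (ℙ F (Fin 3 → F))
  intro p r hpr
  by_contra hne
  obtain ⟨a, ha, har⟩ := (isConicSystem_conicEval (F := F) (K := F)).exists_separating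
    (T := {p}) (by simp) (p := r) (by simpa [eq_comm] using hne)
  rw [singleton_subset_iff, mem_zeroSet] at ha
  apply har
  rw [← mk_rep p, ← mk_rep r] at hpr
  change Projectivization.mk F (veroneseVec p.rep) _ = Projectivization.mk F (veroneseVec r.rep) _
    at hpr
  obtain ⟨c, hc⟩ := (mk_eq_mk_iff' _ _ _ _ _).1 hpr
  rw [conicEval, conicForm_eq_sum] at ha ⊢
  have hc0 : c ≠ 0 := by
    rintro rfl
    exact veroneseVec_ne_zero p.rep_nonzero (by rw [← hc, zero_smul])
  rw [← hc] at ha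
  refine ((mul_eq_zero (a := c)).1 ?_).resolve_left hc0
  rw [← ha, Finset.mul_sum]
  refine sum_congr rfl fun i _ => ?_
  simp
  ring

/-- The columns of a generator matrix of the Veronese code are, up to nonzero scalars, the
Veronese vectors of the points of the plane. -/
theorem IsVeroneseMatrix.exists_equiv {F : Type u} [Field F] [Finite F] {n : ℕ}
    {G : Matrix (Fin 6) (Fin n) F} (hG : IsVeroneseMatrix G) :
    ∃ (e : Fin n ≃ ℙ F (Fin 3 → F)) (c : Fin n → F), (∀ j, c j ≠ 0) ∧
      ∀ i j, G i j = c j * veroneseVec (e j).rep i := by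
  obtain ⟨h, hmaps, hinj, hsurj⟩ := hG
  have hp : ∀ j, ∃ p, veroneseMap F p = Projectivization.mk F (G.col j) (h j) :=
    fun j => hmaps (Set.mem_univ j)
  choose p hp using hp
  have hbij : Function.Bijective p := by
    constructor
    · intro j k hjk
      refine hinj (Set.mem_univ j) (Set.mem_univ k) ?_
      change Projectivization.mk F (G.col j) (h j) = Projectivization.mk F (G.col k) (h k)
      rw [← hp, ← hp, hjk]
    · intro r
      obtain ⟨j, -, hj⟩ := hsurj (Set.mem_range_self r)
      exact ⟨j, veroneseMap_injective F ((hp j).trans hj)⟩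
  have hc : ∀ j, ∃ c : F, c • veroneseVec (p j).rep = G.col j := by
    intro j
    have := hp j
    rw [← mk_rep (p j)] at this
    change Projectivization.mk F (veroneseVec (p j).rep) _ = _ at this
    exact (mk_eq_mk_iff' _ _ _ _ _).1 this.symm
  choose c hc using hc
  refine ⟨Equiv.ofBijective p hbij, c, fun j hj => h j ?_, fun i j => ?_⟩
  · rw [← hc, hj, zero_smul]
  · exact (congrFun (hc j) i).symm

theorem mem_extendCode_rowCode {F : Type u} [Field F] {k n : ℕ} (G : Matrix (Fin k) (Fin n) F)
    (K : Type u) [Field K] [Algebra F K] (c : Fin n → K) :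
    c ∈ extendCode (rowCode G) K ↔
      ∃ a : Fin k → K, ∀ j, c j = ∑ i, a i * algebraMap F K (G i j) := by
  have : extendCode (rowCode G) K
      = Submodule.span K (Set.range fun i j => algebraMap F K (G i j)) := by
    refine le_antisymm (Submodule.span_le.2 ?_) (Submodule.span_mono ?_)
    · rintro _ ⟨w, hw, rfl⟩
      change w ∈ Submodule.span F (Set.range G.row) at hw
      obtain ⟨b, rfl⟩ := (Submodule.mem_span_range_iff_exists_fun F).1 hw
      refine (Submodule.mem_span_range_iff_exists_fun K).2 ⟨fun i => algebraMap F K (b i), ?_⟩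
      funext j
      simp [Finset.sum_apply, Matrix.row, Algebra.smul_def]
    · rintro _ ⟨i, rfl⟩
      exact ⟨G.row i, Submodule.subset_span ⟨i, rfl⟩, rfl⟩
  rw [this, Submodule.mem_span_range_iff_exists_fun]
  refine exists_congr fun a => ?_
  rw [funext_iff]
  refine forall_congr' fun j => ?_
  simp [Finset.sum_apply, eq_comm]

open IsConicSystem

theorem card_arc_hyp {F K : Type*} [Field F] [Field K] [Algebra F K] [Fintype F] [Fintype K]
    [Fintype (ℙ F (Fin 3 → F))] :
    ∀ a ∈ arcConics (ℙ F (Fin 3 → F)) (conicEval K (F := F)), #(zeroSet (conicEval K (F := F)) a)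
      = ProjectivePlane.order (ℙ F (Fin 3 → F)) (ℙ F (Fin 3 → F)) + 1 := by
  intro a ha
  rw [order_projectivization, card_zeroSet_of_mem_arcConics ha]

/-- No nonzero form vanishes at every rational point; this makes the map from forms to words
injective. -/
theorem card_zeroSet_lt {F K : Type*} [Field F] [Field K] [Algebra F K] [Fintype F] [Fintype K]
    [Fintype (ℙ F (Fin 3 → F))] (hq : 4 ≤ Fintype.card F) {a : Fin 6 → K} (ha : a ≠ 0) :
    #(zeroSet (conicEval K (F := F)) a) < Fintype.card F ^ 2 + Fintype.card F + 1 := by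
  have := (isConicSystem_conicEval (F := F) (K := K)).card_zeroSet_mem card_arc_hyp ha
  rw [order_projectivization] at this
  simp only [mem_insert, mem_singleton] at this
  have h2 : 4 * Fintype.card F ≤ Fintype.card F ^ 2 := by nlinarith
  omega

/-- The words of weight `w` in the extended Veronese code correspond to the conics with
`n - w` rational points. -/
theorem ncard_words {F K : Type u} [Field F] [Field K] [Algebra F K] [Fintype F] [Fintype K]
    [Fintype (ℙ F (Fin 3 → F))] (hq : 4 ≤ Fintype.card F) {n : ℕ}
    (hn : n = Fintype.card F ^ 2 + Fintype.card F + 1)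
    {G : Matrix (Fin 6) (Fin n) F} (hG : IsVeroneseMatrix G) (w : ℕ) :
    {c : Fin n → K | c ∈ extendCode (rowCode G) K ∧ wordWeight c = w}.ncard
      = #{a : Fin 6 → K | #(zeroSet (conicEval K (F := F)) a) + w = n} := by
  obtain ⟨e, s, hs, hGs⟩ := hG.exists_equiv
  let word : (Fin 6 → K) →ₗ[K] (Fin n → K) :=
    LinearMap.pi fun j => algebraMap F K (s j) • conicEval K (e j)
  have hword : ∀ a j, word a j = algebraMap F K (s j) * conicEval K (e j) a := fun a j => rfl
  have hs' : ∀ j, algebraMap F K (s j) ≠ 0 := fun j => by simpa using hs j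
  have hinj : Function.Injective word := by
    rw [← LinearMap.ker_eq_bot, LinearMap.ker_eq_bot']
    intro a ha
    by_contra ha0
    have hlt := card_zeroSet_lt (F := F) hq ha0
    have : zeroSet (conicEval K (F := F)) a = univ := by
      ext p
      have := congrFun ha (e.symm p)
      simpa [hword, hs'] using this
    rw [this, card_univ, ← Fintype.card_congr e, Fintype.card_fin] at hlt
    omega
  have hwt : ∀ a, wordWeight (word a) + #(zeroSet (conicEval K (F := F)) a) = n := by
    intro a
    have h1 : Function.support (word a)
        = ((univ.filter fun j => e j ∉ zeroSet (conicEval K (F := F)) a : Finset (Fin n)) :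
          Set (Fin n)) := by
      ext j
      simp [hword, hs']
    have h2 : #(zeroSet (conicEval K (F := F)) a)
        = #(univ.filter fun j => e j ∈ zeroSet (conicEval K (F := F)) a) := by
      refine (card_bij (fun j _ => e j) ?_ ?_ ?_).symm
      · intro j hj
        exact (mem_filter.1 hj).2
      · intro i _ j _ hij
        exact e.injective hij
      · intro p hp
        exact ⟨e.symm p, by simpa using hp, by simp⟩
    rw [wordWeight, h1, Set.ncard_coe_finset, h2, add_comm, card_filter_add_card_filter_not,
      card_univ, Fintype.card_fin]
  rw [← Set.ncard_coe_finset, ← Set.ncard_image_of_injective _ hinj]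
  congr 1
  ext c
  simp only [Set.mem_ofPred_eq, Set.mem_image, mem_extendCode_rowCode, coe_filter, mem_univ,
    true_and]
  have hmem : ∀ a : Fin 6 → K, (∀ j, c j = ∑ i, a i * algebraMap F K (G i j)) ↔ word a = c := by
    intro a
    rw [funext_iff]
    refine forall_congr' fun j => ?_
    rw [hword, conicEval, conicForm_eq_sum, Finset.mul_sum, eq_comm]
    refine Eq.congr (sum_congr rfl fun i _ => ?_) rfl
    rw [hGs, map_mul]
    ring
  constructor
  · rintro ⟨⟨a, ha⟩, hw⟩
    rw [hmem] at ha
    refine ⟨a, ?_, ha⟩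
    rw [← hw, ← ha, add_comm, hwt]
  · rintro ⟨a, ha, hac⟩
    refine ⟨⟨a, (hmem a).2 hac⟩, ?_⟩
    have := hwt a
    rw [hac] at this
    omega

theorem finite_of_finrank {F K : Type*} [Field F] [Finite F] [Field K] [Algebra F K] {m : ℕ}
    (hm : 1 ≤ m) (hK : Module.finrank F K = m) : Finite K := by
  have : Module.Finite F K := Module.finite_of_finrank_pos (by omega)
  exact Module.finite_of_finite F

theorem isGenWeightPoly_of_card {F : Type u} [Field F] [Fintype F] [Fintype (ℙ F (Fin 3 → F))]
    (hq : 4 ≤ Fintype.card F) {n : ℕ} (hn : n = Fintype.card F ^ 2 + Fintype.card F + 1)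
    {G : Matrix (Fin 6) (Fin n) F} (hG : IsVeroneseMatrix G) {w : ℕ} {Q : ℤ[X]}
    (hQ : ∀ (K : Type u) [Field K] [Fintype K] [Algebra F K],
      (Q.map (Int.castRingHom ℚ)).eval (Fintype.card K : ℚ)
        = #{a : Fin 6 → K | #(zeroSet (conicEval K (F := F)) a) + w = n}) :
    IsGenWeightPoly (rowCode G) w Q := by
  intro m hm K _ _ hK
  have := finite_of_finrank hm hK
  have := Fintype.ofFinite K
  rw [ncard_words hq hn hG w]
  have h := hQ K
  have hcard : (Fintype.card K : ℚ) = ((Fintype.card F : ℤ) ^ m : ℤ) := by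
    rw [Module.card_eq_pow_finrank (K := F) (V := K), hK]
    push_cast
    rfl
  rw [hcard, eval_intCast_map] at h
  rw [Nat.card_eq_fintype_card]
  simp only [eq_intCast] at h
  exact_mod_cast h

/-- The condition `k ≠ n` excludes the zero form, which `conicsWith` leaves out. -/
theorem isGenWeightPoly_of_conicsWith {F : Type u} [Field F] [Fintype F]
    [Fintype (ℙ F (Fin 3 → F))]
    (hq : 4 ≤ Fintype.card F) {n : ℕ} (hn : n = Fintype.card F ^ 2 + Fintype.card F + 1)
    {G : Matrix (Fin 6) (Fin n) F} (hG : IsVeroneseMatrix G) {w k : ℕ} (hw : k + w = n)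
    (hk : k ≠ n) {Q : ℤ[X]}
    (hQ : ∀ (K : Type u) [Field K] [Fintype K] [Algebra F K],
      (Q.map (Int.castRingHom ℚ)).eval (Fintype.card K : ℚ)
        = #(conicsWith (conicEval K (F := F)) k)) :
    IsGenWeightPoly (rowCode G) w Q := by
  refine isGenWeightPoly_of_card hq hn hG fun K _ _ _ => ?_
  rw [hQ K]
  congr 2
  ext a
  rw [mem_conicsWith, mem_filter]
  simp only [mem_univ, true_and]
  constructor
  · rintro ⟨-, h⟩
    omega
  · intro h
    refine ⟨?_, by omega⟩
    rintro rfl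
    rw [zeroSet_zero, card_univ, ProjectivePlane.card_points (ℙ F (Fin 3 → F)) (ℙ F (Fin 3 → F)),
      order_projectivization] at h
    omega

theorem exists_extension (F : Type u) [Field F] [Finite F] {m : ℕ} (hm : 1 ≤ m) :
    ∃ (K : Type u) (_ : Field K) (_ : Algebra F K), Module.finrank F K = m := by
  obtain ⟨p, _⟩ := CharP.exists F
  have : Fact p.Prime := ⟨CharP.char_is_prime F p⟩
  have : NeZero m := ⟨by omega⟩
  exact ⟨ULift.{u} (FiniteField.Extension F p m), inferInstance, inferInstance,
    (ULift.moduleEquiv (R := F) (M := FiniteField.Extension F p m)).finrank_eq.trans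
      (FiniteField.finrank_extension F p m)⟩

/-- An extension of every degree exists, so both polynomials are prescribed at infinitely many
powers of `q`. -/
theorem IsGenWeightPoly.unique {F : Type u} [Field F] [Finite F] {n : ℕ}
    {D : Submodule F (Fin n → F)} {w : ℕ} {Q R : ℤ[X]} (hQ : IsGenWeightPoly D w Q)
    (hR : IsGenWeightPoly D w R) : Q = R := by
  have hq : 1 < Nat.card F := Finite.one_lt_card
  refine Polynomial.eq_of_infinite_eval_eq Q R ?_
  refine Set.infinite_of_injective_forall_mem
    (f := fun m : ℕ => (Nat.card F : ℤ) ^ (m + 1)) ?_ ?_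
  · intro m k hmk
    beta_reduce at hmk
    have : Nat.card F ^ (m + 1) = Nat.card F ^ (k + 1) := by exact_mod_cast hmk
    have := Nat.pow_right_injective hq this
    omega
  · intro m
    obtain ⟨K, _, _, hK⟩ := exists_extension F (m := m + 1) (by omega)
    exact (hQ (m + 1) (by omega) K hK).trans (hR (m + 1) (by omega) K hK).symm

end VeroneseCode

/-! ### Integrality of the coefficients -/

section Integrality

/-- Reduces each divisibility below to a finite check over the residues of `q`, so it holds for
every integer `q`. -/
theorem dvd_of_zmod (d : ℕ) (f : ℤ) (h : (f : ZMod d) = 0) : (d : ℤ) ∣ f :=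
  (ZMod.intCast_zmod_eq_zero_iff_dvd f d).1 h

theorem dvd_coeff_four (q : ℤ) :
    (24 : ℤ) ∣ (q ^ 2 + q + 1) * (q + 1) * q ^ 3 * (q - 1) ^ 2 := by
  refine dvd_of_zmod 24 _ ?_
  push_cast
  generalize (q : ZMod 24) = x
  revert x
  decide

theorem dvd_coeff_three (q : ℤ) : (6 : ℤ) ∣ (q ^ 2 + q + 1) * (q + 1) * q ^ 3 := by
  refine dvd_of_zmod 6 _ ?_
  push_cast
  generalize (q : ZMod 6) = x
  revert x
  decide

theorem dvd_coeff_two (q : ℤ) : (2 : ℤ) ∣ (q + 1) * q := by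
  refine dvd_of_zmod 2 _ ?_
  push_cast
  generalize (q : ZMod 2) = x
  revert x
  decide

theorem dvd_coeff_two' (q : ℤ) : (2 : ℤ) ∣ q ^ 4 - 4 * q ^ 3 + 7 * q ^ 2 - 4 * q := by
  refine dvd_of_zmod 2 _ ?_
  push_cast
  generalize (q : ZMod 2) = x
  revert x
  decide

theorem dvd_coeff_one (q : ℤ) : (6 : ℤ) ∣ 3 * q ^ 4 + 3 * q ^ 3 - 6 * q := by
  refine dvd_of_zmod 6 _ ?_
  push_cast
  generalize (q : ZMod 6) = x
  revert x
  decide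

theorem dvd_coeff_one' (q : ℤ) :
    (6 : ℤ) ∣ q ^ 6 - q ^ 5 + 5 * q ^ 4 - 5 * q ^ 3 - 6 * q ^ 2 + 6 * q := by
  refine dvd_of_zmod 6 _ ?_
  push_cast
  generalize (q : ZMod 6) = x
  revert x
  decide

theorem dvd_coeff_one'' (q : ℤ) :
    (6 : ℤ) ∣ q ^ 7 - 4 * q ^ 6 + 8 * q ^ 5 - 5 * q ^ 4 - 6 * q ^ 3 + 9 * q ^ 2 - 3 * q := by
  refine dvd_of_zmod 6 _ ?_
  push_cast
  generalize (q : ZMod 6) = x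
  revert x
  decide

theorem dvd_coeff_zero (q : ℤ) : (24 : ℤ) ∣ 12 * q ^ 4 - 12 * q := by
  refine dvd_of_zmod 24 _ ?_
  push_cast
  generalize (q : ZMod 24) = x
  revert x
  decide

theorem dvd_coeff_zero' (q : ℤ) :
    (24 : ℤ) ∣ 4 * q ^ 6 - 4 * q ^ 5 + 8 * q ^ 4 - 20 * q ^ 3 + 12 * q ^ 2 := by
  refine dvd_of_zmod 24 _ ?_
  push_cast
  generalize (q : ZMod 24) = x
  revert x
  decide

theorem dvd_coeff_zero'' (q : ℤ) :
    (24 : ℤ) ∣ q ^ 8 - 4 * q ^ 7 + 11 * q ^ 6 - 17 * q ^ 5 + 12 * q ^ 4 - 3 * q ^ 3 := by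
  refine dvd_of_zmod 24 _ ?_
  push_cast
  generalize (q : ZMod 24) = x
  revert x
  decide

end Integrality

/-! ### The weight polynomials -/

section VeroneseWeights

/-- The rational polynomials counting conics have integer coefficients. -/
theorem exists_integral_polynomials (q : ℕ) :
    ∃ P₁ P₂ P₃ P₄ P₅ P₆ P₇ P₈ : ℤ[X],
      P₁.map (Int.castRingHom ℚ) = C ((q ^ 2 + q + 1).choose 2 : ℚ) * (X - 1) ∧
      P₂.map (Int.castRingHom ℚ) =
        C (((q : ℚ) ^ 2 + q + 1) * q ^ 2) * (X - C (q : ℚ)) * (X - 1) ∧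
      P₃.map (Int.castRingHom ℚ) =
        C ((q : ℚ) ^ 2 + q + 1) * (X - 1) *
          (X ^ 2 - C ((q : ℚ) ^ 2 - 1) * X + C (2 * (q : ℚ) ^ 3 - 2 * q ^ 2 - q + 1)) ∧
      P₄.map (Int.castRingHom ℚ) =
        C (((q : ℚ) ^ 2 + q + 1) * (q + 1) * q ^ 3 * (q - 1) ^ 2 / 24) *
          (X - C (q : ℚ)) * (X - 1) ∧
      P₅.map (Int.castRingHom ℚ) =
        C (((q : ℚ) ^ 2 + q + 1) * (q + 1) * q ^ 3 / 6) *
          (X - 1) * (X - C (q : ℚ)) * (X - C ((q : ℚ) ^ 2 - 3 * q + 3)) ∧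
      P₆.map (Int.castRingHom ℚ) =
        C (((q : ℚ) ^ 2 + q + 1) * (q + 1) * q / 4) *
          (X - 1) * (X - C (q : ℚ)) *
          (2 * X ^ 2 - C (2 * ((q : ℚ) ^ 2 - q)) * X
            + C ((q : ℚ) ^ 4 - 4 * q ^ 3 + 7 * q ^ 2 - 4 * q)) ∧
      P₇.map (Int.castRingHom ℚ) =
        C (((q : ℚ) ^ 2 + q + 1) / 6) * (X - 1) *
          (6 * X ^ 4 - C (6 * (q : ℚ) ^ 2 + 6 * q - 6) * X ^ 3
            + C (3 * (q : ℚ) ^ 4 + 3 * q ^ 3 - 6 * q) * X ^ 2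
            - C ((q : ℚ) ^ 6 - q ^ 5 + 5 * q ^ 4 - 5 * q ^ 3 - 6 * q ^ 2 + 6 * q) * X
            + C ((q : ℚ) ^ 7 - 4 * q ^ 6 + 8 * q ^ 5 - 5 * q ^ 4 - 6 * q ^ 3 + 9 * q ^ 2
                - 3 * q)) ∧
      P₈.map (Int.castRingHom ℚ) =
        C (1 / 24 : ℚ) * (X - 1) * (X - C (q : ℚ)) *
          (24 * X ^ 4 - C (24 * (q : ℚ) ^ 2) * X ^ 3
            + C (12 * (q : ℚ) ^ 4 - 12 * q) * X ^ 2
            - C (4 * (q : ℚ) ^ 6 - 4 * q ^ 5 + 8 * q ^ 4 - 20 * q ^ 3 + 12 * q ^ 2) * X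
            + C ((q : ℚ) ^ 8 - 4 * q ^ 7 + 11 * q ^ 6 - 17 * q ^ 5 + 12 * q ^ 4
                - 3 * q ^ 3)) := by
  obtain ⟨k₄, h₄⟩ := dvd_coeff_four q
  obtain ⟨k₃, h₃⟩ := dvd_coeff_three q
  obtain ⟨k₂, h₂⟩ := dvd_coeff_two q
  obtain ⟨l₂, g₂⟩ := dvd_coeff_two' q
  obtain ⟨k₁, h₁⟩ := dvd_coeff_one q
  obtain ⟨l₁, g₁⟩ := dvd_coeff_one' q
  obtain ⟨m₁, e₁⟩ := dvd_coeff_one'' q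
  obtain ⟨k₀, h₀⟩ := dvd_coeff_zero q
  obtain ⟨l₀, g₀⟩ := dvd_coeff_zero' q
  obtain ⟨m₀, e₀⟩ := dvd_coeff_zero'' q
  replace h₄ := congrArg (Int.cast : ℤ → ℚ) h₄
  replace h₃ := congrArg (Int.cast : ℤ → ℚ) h₃
  replace h₂ := congrArg (Int.cast : ℤ → ℚ) h₂
  replace g₂ := congrArg (Int.cast : ℤ → ℚ) g₂
  replace h₁ := congrArg (Int.cast : ℤ → ℚ) h₁
  replace g₁ := congrArg (Int.cast : ℤ → ℚ) g₁
  replace e₁ := congrArg (Int.cast : ℤ → ℚ) e₁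
  replace h₀ := congrArg (Int.cast : ℤ → ℚ) h₀
  replace g₀ := congrArg (Int.cast : ℤ → ℚ) g₀
  replace e₀ := congrArg (Int.cast : ℤ → ℚ) e₀
  push_cast at h₄ h₃ h₂ g₂ h₁ g₁ e₁ h₀ g₀ e₀
  refine ⟨C ((q ^ 2 + q + 1).choose 2 : ℤ) * (X - 1),
    C (((q : ℤ) ^ 2 + q + 1) * q ^ 2) * (X - C (q : ℤ)) * (X - 1),
    C ((q : ℤ) ^ 2 + q + 1) * (X - 1) *
      (X ^ 2 - C ((q : ℤ) ^ 2 - 1) * X + C (2 * (q : ℤ) ^ 3 - 2 * q ^ 2 - q + 1)),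
    C k₄ * (X - C (q : ℤ)) * (X - 1),
    C k₃ * (X - 1) * (X - C (q : ℤ)) * (X - C ((q : ℤ) ^ 2 - 3 * q + 3)),
    -- The denominator `4` is split: one factor `2` divides `(q + 1) * q`, the other divides the
    -- quadratic factor. In the next two polynomials the whole denominator divides the quartic.
    C (((q : ℤ) ^ 2 + q + 1) * k₂) * (X - 1) * (X - C (q : ℤ)) *
      (X ^ 2 - C ((q : ℤ) ^ 2 - q) * X + C l₂),
    C ((q : ℤ) ^ 2 + q + 1) * (X - 1) * (X ^ 4 - C ((q : ℤ) ^ 2 + q - 1) * X ^ 3 + C k₁ * X ^ 2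
      - C l₁ * X + C m₁),
    (X - 1) * (X - C (q : ℤ)) * (X ^ 4 - C ((q : ℤ) ^ 2) * X ^ 3 + C k₀ * X ^ 2
      - C l₀ * X + C m₀), ?_, ?_, ?_, ?_, ?_, ?_, ?_, ?_⟩
  · simp
  · simp
  · refine Polynomial.funext fun x => ?_
    simp
  · rw [h₄]
    simp
  · rw [h₃]
    refine Polynomial.funext fun x => ?_
    simp
  · rw [g₂, show ((q : ℚ) ^ 2 + q + 1) * (q + 1) * q / 4
      = ((q : ℚ) ^ 2 + q + 1) * k₂ * (1 / 2) by linear_combination (q ^ 2 + q + 1) / 4 * h₂]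
    refine Polynomial.funext fun x => ?_
    simp
    ring
  · rw [h₁, g₁, e₁]
    refine Polynomial.funext fun x => ?_
    simp
    ring
  · rw [h₀, g₀, e₀]
    refine Polynomial.funext fun x => ?_
    simp
    ring

theorem quadratic_ne_zero {a : ℚ} (ha : a ≠ 0) (b c : ℚ) :
    C a * X ^ 2 - C b * X + C c ≠ 0 := by
  have : natDegree (C a * X ^ 2 - C b * X + C c) = 2 := by compute_degree!
  exact ne_zero_of_natDegree_gt (n := 1) (by omega)

theorem quartic_ne_zero {a : ℚ} (ha : a ≠ 0) (b c d e : ℚ) :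
    C a * X ^ 4 - C b * X ^ 3 + C c * X ^ 2 - C d * X + C e ≠ 0 := by
  have : natDegree (C a * X ^ 4 - C b * X ^ 3 + C c * X ^ 2 - C d * X + C e) = 4 := by
    compute_degree!
  exact ne_zero_of_natDegree_gt (n := 3) (by omega)

end VeroneseWeights

/-! ### The main theorem -/

set_option maxHeartbeats 1000000 in
theorem theorem3p8 {F : Type u} [Field F] [Finite F] (q : ℕ) (hF : Nat.card F = q)
    (hq : 4 ≤ q) (G : Matrix (Fin 6) (Fin (q ^ 2 + q + 1)) F) (hG : IsVeroneseMatrix G) :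
    ∃ P : ℕ → ℤ[X],
      (∀ (w : ℕ) (Q : ℤ[X]), IsGenWeightPoly (rowCode G) w Q ↔ Q = P w) ∧
      {w : ℕ | P w ≠ 0} =
        {0, q ^ 2 - q, q ^ 2 - 1, q ^ 2, q ^ 2 + q - 3, q ^ 2 + q - 2, q ^ 2 + q - 1,
          q ^ 2 + q, q ^ 2 + q + 1} ∧
      {w : ℕ | P w ≠ 0}.ncard = 9 ∧
      P 0 = 1 ∧
      (P (q ^ 2 - q)).map (Int.castRingHom ℚ) =
        C ((q ^ 2 + q + 1).choose 2 : ℚ) * (X - 1) ∧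
      (P (q ^ 2 - 1)).map (Int.castRingHom ℚ) =
        C (((q : ℚ) ^ 2 + q + 1) * q ^ 2) * (X - C (q : ℚ)) * (X - 1) ∧
      (P (q ^ 2)).map (Int.castRingHom ℚ) =
        C ((q : ℚ) ^ 2 + q + 1) * (X - 1) *
          (X ^ 2 - C ((q : ℚ) ^ 2 - 1) * X + C (2 * (q : ℚ) ^ 3 - 2 * q ^ 2 - q + 1)) ∧
      (P (q ^ 2 + q - 3)).map (Int.castRingHom ℚ) =
        C (((q : ℚ) ^ 2 + q + 1) * (q + 1) * q ^ 3 * (q - 1) ^ 2 / 24) *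
          (X - C (q : ℚ)) * (X - 1) ∧
      (P (q ^ 2 + q - 2)).map (Int.castRingHom ℚ) =
        C (((q : ℚ) ^ 2 + q + 1) * (q + 1) * q ^ 3 / 6) *
          (X - 1) * (X - C (q : ℚ)) * (X - C ((q : ℚ) ^ 2 - 3 * q + 3)) ∧
      (P (q ^ 2 + q - 1)).map (Int.castRingHom ℚ) =
        C (((q : ℚ) ^ 2 + q + 1) * (q + 1) * q / 4) *
          (X - 1) * (X - C (q : ℚ)) *
          (2 * X ^ 2 - C (2 * ((q : ℚ) ^ 2 - q)) * X
            + C ((q : ℚ) ^ 4 - 4 * q ^ 3 + 7 * q ^ 2 - 4 * q)) ∧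
      (P (q ^ 2 + q)).map (Int.castRingHom ℚ) =
        C (((q : ℚ) ^ 2 + q + 1) / 6) * (X - 1) *
          (6 * X ^ 4 - C (6 * (q : ℚ) ^ 2 + 6 * q - 6) * X ^ 3
            + C (3 * (q : ℚ) ^ 4 + 3 * q ^ 3 - 6 * q) * X ^ 2
            - C ((q : ℚ) ^ 6 - q ^ 5 + 5 * q ^ 4 - 5 * q ^ 3 - 6 * q ^ 2 + 6 * q) * X
            + C ((q : ℚ) ^ 7 - 4 * q ^ 6 + 8 * q ^ 5 - 5 * q ^ 4 - 6 * q ^ 3 + 9 * q ^ 2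
                - 3 * q)) ∧
      (P (q ^ 2 + q + 1)).map (Int.castRingHom ℚ) =
        C (1 / 24 : ℚ) * (X - 1) * (X - C (q : ℚ)) *
          (24 * X ^ 4 - C (24 * (q : ℚ) ^ 2) * X ^ 3
            + C (12 * (q : ℚ) ^ 4 - 12 * q) * X ^ 2
            - C (4 * (q : ℚ) ^ 6 - 4 * q ^ 5 + 8 * q ^ 4 - 20 * q ^ 3 + 12 * q ^ 2) * X
            + C ((q : ℚ) ^ 8 - 4 * q ^ 7 + 11 * q ^ 6 - 17 * q ^ 5 + 12 * q ^ 4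
                - 3 * q ^ 3)) := by
  classical
  subst hF
  have := Fintype.ofFinite F
  have := Fintype.ofFinite (ℙ F (Fin 3 → F))
  have hqc : Nat.card F = Fintype.card F := Nat.card_eq_fintype_card
  have hq' : 4 ≤ Fintype.card F := by rwa [← hqc]
  have hord : Configuration.ProjectivePlane.order (ℙ F (Fin 3 → F)) (ℙ F (Fin 3 → F)) = Nat.card F := by
    rw [hqc, order_projectivization]
  generalize hqdef : Nat.card F = q at *
  have hn : q ^ 2 + q + 1 = Fintype.card F ^ 2 + Fintype.card F + 1 := by rw [← hqc]
  -- Lets `omega`, which treats `q ^ 2` as an atom, handle the truncated subtractions and separate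
  -- the weights.
  have hs : 4 * q ≤ q ^ 2 := by nlinarith
  have hQ : (4 : ℚ) ≤ q := by exact_mod_cast hq
  have counts := fun (K : Type u) [Field K] [Fintype K] [Algebra F K] =>
    (isConicSystem_conicEval (F := F) (K := K)).card_conicsWith (q := (q : ℚ)) (by rw [hord])
      (by rw [hord]; exact hq) rfl card_arc_hyp
      ((isConicSystem_conicEval (F := F) (K := K)).card_arcConics
        (isConicSystem_conicEval (F := F) (K := F)) (by rw [hord]) (by rw [hord]; exact hq)
        (by rw [hord, hqc]) rfl
        (fun a ha h2 => by rw [hord, hqc]; exact card_zeroSet_of_linesIn_eq_empty ha h2)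
        card_arc_hyp)
  simp only [hord] at counts
  obtain ⟨P₁, P₂, P₃, P₄, P₅, P₆, P₇, P₈, e₁, e₂, e₃, e₄, e₅, e₆, e₇, e₈⟩ :=
    exists_integral_polynomials q
  have g₁ : IsGenWeightPoly (rowCode G) (q ^ 2 - q) P₁ :=
    isGenWeightPoly_of_conicsWith hq' hn hG (k := 2 * q + 1) (by omega) (by omega)
      fun K _ _ _ => by
        rw [(counts K).1, e₁, Nat.cast_choose_two]
        simp
  have g₂ : IsGenWeightPoly (rowCode G) (q ^ 2 - 1) P₂ :=
    isGenWeightPoly_of_conicsWith hq' hn hG (k := q + 2) (by omega) (by omega)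
      fun K _ _ _ => by
        rw [(counts K).2.1, e₂]
        simp
  have g₃ : IsGenWeightPoly (rowCode G) (q ^ 2) P₃ :=
    isGenWeightPoly_of_conicsWith hq' hn hG (k := q + 1) (by omega) (by omega)
      fun K _ _ _ => by
        rw [(counts K).2.2.1, e₃]
        simp
  have g₄ : IsGenWeightPoly (rowCode G) (q ^ 2 + q - 3) P₄ :=
    isGenWeightPoly_of_conicsWith hq' hn hG (k := 4) (by omega) (by omega)
      fun K _ _ _ => by
        rw [(counts K).2.2.2.1, e₄]
        simp
  have g₅ : IsGenWeightPoly (rowCode G) (q ^ 2 + q - 2) P₅ :=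
    isGenWeightPoly_of_conicsWith hq' hn hG (k := 3) (by omega) (by omega)
      fun K _ _ _ => by
        rw [(counts K).2.2.2.2.1, e₅]
        simp
  have g₆ : IsGenWeightPoly (rowCode G) (q ^ 2 + q - 1) P₆ :=
    isGenWeightPoly_of_conicsWith hq' hn hG (k := 2) (by omega) (by omega)
      fun K _ _ _ => by
        rw [(counts K).2.2.2.2.2.1, e₆]
        simp
  have g₇ : IsGenWeightPoly (rowCode G) (q ^ 2 + q) P₇ :=
    isGenWeightPoly_of_conicsWith hq' hn hG (k := 1) (by omega) (by omega)
      fun K _ _ _ => by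
        rw [(counts K).2.2.2.2.2.2.1, e₇]
        simp
  have g₈ : IsGenWeightPoly (rowCode G) (q ^ 2 + q + 1) P₈ :=
    isGenWeightPoly_of_conicsWith hq' hn hG (k := 0) (by omega) (by omega)
      fun K _ _ _ => by
        rw [(counts K).2.2.2.2.2.2.2, e₈]
        simp
  -- Weight zero is treated apart, since its only form is the zero form.
  have g₀ : IsGenWeightPoly (rowCode G) 0 1 := by
    refine isGenWeightPoly_of_card hq' hn hG fun K _ _ _ => ?_
    rw [Polynomial.map_one, eval_one, eq_comm, Nat.cast_eq_one, Finset.card_eq_one]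
    refine ⟨0, Finset.ext fun a => ?_⟩
    rw [Finset.mem_filter, Finset.mem_singleton]
    simp only [Finset.mem_univ, true_and, add_zero]
    constructor
    · intro h
      by_contra h0
      have := card_zeroSet_lt (F := F) hq' h0
      omega
    · rintro rfl
      rw [IsConicSystem.zeroSet_zero, Finset.card_univ,
        Configuration.ProjectivePlane.card_points (ℙ F (Fin 3 → F)) (ℙ F (Fin 3 → F)), hord]
  have gnone : ∀ w, w ∉ ({0, q ^ 2 - q, q ^ 2 - 1, q ^ 2, q ^ 2 + q - 3, q ^ 2 + q - 2,
      q ^ 2 + q - 1, q ^ 2 + q, q ^ 2 + q + 1} : Set ℕ) →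
      IsGenWeightPoly (rowCode G) w 0 := by
    intro w hw
    simp only [Set.mem_insert_iff, Set.mem_singleton_iff, not_or] at hw
    refine isGenWeightPoly_of_card hq' hn hG fun K _ _ _ => ?_
    rw [Polynomial.map_zero, eval_zero, eq_comm, Nat.cast_eq_zero, Finset.card_eq_zero,
      Finset.eq_empty_iff_forall_notMem]
    intro a ha
    rw [Finset.mem_filter] at ha
    by_cases h0 : a = 0
    · subst h0
      rw [IsConicSystem.zeroSet_zero, Finset.card_univ,
        Configuration.ProjectivePlane.card_points (ℙ F (Fin 3 → F)) (ℙ F (Fin 3 → F)), hord] at ha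
      omega
    · have h := (isConicSystem_conicEval (F := F) (K := K)).card_zeroSet_mem card_arc_hyp h0
      rw [hord] at h
      simp only [Finset.mem_insert, Finset.mem_singleton] at h
      omega
  have hex : ∀ w, ∃ Q, IsGenWeightPoly (rowCode G) w Q := by
    intro w
    by_cases hw : w ∈ ({0, q ^ 2 - q, q ^ 2 - 1, q ^ 2, q ^ 2 + q - 3, q ^ 2 + q - 2,
      q ^ 2 + q - 1, q ^ 2 + q, q ^ 2 + q + 1} : Set ℕ)
    · simp only [Set.mem_insert_iff, Set.mem_singleton_iff] at hw
      rcases hw with rfl | rfl | rfl | rfl | rfl | rfl | rfl | rfl | rfl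
      exacts [⟨_, g₀⟩, ⟨_, g₁⟩, ⟨_, g₂⟩, ⟨_, g₃⟩, ⟨_, g₄⟩, ⟨_, g₅⟩, ⟨_, g₆⟩, ⟨_, g₇⟩, ⟨_, g₈⟩]
    · exact ⟨0, gnone w hw⟩
  -- Choosing any weight polynomial for each `w` is harmless: uniqueness identifies it with the
  -- explicit one.
  choose P hP using hex
  have i₀ := (hP _).unique g₀
  have i₁ := (hP _).unique g₁
  have i₂ := (hP _).unique g₂
  have i₃ := (hP _).unique g₃
  have i₄ := (hP _).unique g₄
  have i₅ := (hP _).unique g₅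
  have i₆ := (hP _).unique g₆
  have i₇ := (hP _).unique g₇
  have i₈ := (hP _).unique g₈
  have hX : (X - 1 : ℚ[X]) ≠ 0 := by simpa using X_sub_C_ne_zero (1 : ℚ)
  have hXq : (X - C (q : ℚ) : ℚ[X]) ≠ 0 := X_sub_C_ne_zero _
  have hq0 : (q : ℚ) ≠ 0 := by linarith
  have hq2 : (q : ℚ) - 1 ≠ 0 := by linarith
  have hq3 : (q : ℚ) ^ 2 + q + 1 ≠ 0 := by positivity
  have hset : {w : ℕ | P w ≠ 0} = {0, q ^ 2 - q, q ^ 2 - 1, q ^ 2, q ^ 2 + q - 3,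
      q ^ 2 + q - 2, q ^ 2 + q - 1, q ^ 2 + q, q ^ 2 + q + 1} := by
    refine Set.Subset.antisymm (fun w hw => ?_) (fun w hw => ?_)
    · by_contra hn
      exact hw ((hP w).unique (gnone w hn))
    · change P w ≠ 0
      have hmap : (P w).map (Int.castRingHom ℚ) ≠ 0 → P w ≠ 0 := fun h h0 => h (by simp [h0])
      simp only [Set.mem_insert_iff, Set.mem_singleton_iff] at hw
      rcases hw with rfl | rfl | rfl | rfl | rfl | rfl | rfl | rfl | rfl
      · rw [i₀]
        exact one_ne_zero
      · refine hmap ?_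
        rw [i₁, e₁]
        exact mul_ne_zero (C_ne_zero.2 (by exact_mod_cast (Nat.choose_pos (by omega)).ne')) hX
      · refine hmap ?_
        rw [i₂, e₂]
        exact mul_ne_zero (mul_ne_zero (C_ne_zero.2 (by positivity)) hXq) hX
      · refine hmap ?_
        rw [i₃, e₃]
        refine mul_ne_zero (mul_ne_zero (C_ne_zero.2 hq3) hX) ?_
        rw [← one_mul (X ^ 2), ← C_1]
        exact quadratic_ne_zero one_ne_zero _ _
      · refine hmap ?_
        rw [i₄, e₄]
        exact mul_ne_zero (mul_ne_zero (C_ne_zero.2 (by positivity)) hXq) hX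
      · refine hmap ?_
        rw [i₅, e₅]
        exact mul_ne_zero (mul_ne_zero (mul_ne_zero (C_ne_zero.2 (by positivity)) hX) hXq)
          (X_sub_C_ne_zero _)
      · refine hmap ?_
        rw [i₆, e₆]
        refine mul_ne_zero (mul_ne_zero (mul_ne_zero (C_ne_zero.2 (by positivity)) hX) hXq) ?_
        rw [← map_ofNat C 2]
        exact quadratic_ne_zero two_ne_zero _ _
      · refine hmap ?_
        rw [i₇, e₇]
        refine mul_ne_zero (mul_ne_zero (C_ne_zero.2 (by positivity)) hX) ?_
        rw [← map_ofNat C 6]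
        exact quartic_ne_zero (by norm_num) _ _ _ _
      · refine hmap ?_
        rw [i₈, e₈]
        refine mul_ne_zero (mul_ne_zero (mul_ne_zero (C_ne_zero.2 (by norm_num)) hX) hXq) ?_
        rw [← map_ofNat C 24]
        exact quartic_ne_zero (by norm_num) _ _ _ _
  refine ⟨P, fun w Q => ⟨fun h => h.unique (hP w), fun h => h ▸ hP w⟩, hset, ?_, i₀,
    by rw [i₁, e₁], by rw [i₂, e₂], by rw [i₃, e₃], by rw [i₄, e₄], by rw [i₅, e₅],
    by rw [i₆, e₆], by rw [i₇, e₇], by rw [i₈, e₈]⟩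
  rw [hset]
  have : ({0, q ^ 2 - q, q ^ 2 - 1, q ^ 2, q ^ 2 + q - 3, q ^ 2 + q - 2, q ^ 2 + q - 1,
      q ^ 2 + q, q ^ 2 + q + 1} : Set ℕ) = (({0, q ^ 2 - q, q ^ 2 - 1, q ^ 2, q ^ 2 + q - 3,
      q ^ 2 + q - 2, q ^ 2 + q - 1, q ^ 2 + q, q ^ 2 + q + 1} : Finset ℕ) : Set ℕ) := by
    simp
  rw [this, Set.ncard_coe_finset]
  repeat rw [Finset.card_insert_of_notMem
    (by simp only [Finset.mem_insert, Finset.mem_singleton]; omega)]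
  rw [Finset.card_singleton]
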